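/- Let $$\mathsf N=\begin{pmatrix}0&1&0&0&0\\0&0&0&0&0\\0&0&0&1&0\\0&0&0&0&1\\0&0&0&0&0\end{pmatrix},\qquad \mathsf M=\mathsf N^{T},$$ so that $\mathsf N$ is the nilpotent matrix in Jordan normal form with blocks of sizes $2$ and $3$; its nilpotency index is $p=3$. For a matrix $A$ and a polynomial map $\varphi:\mathbb R^5\to\mathbb R^5$ put $(A_\star\varphi)(x)=A\varphi(x)$, $(S_A\varphi)(x)=\varphi(Ax)$, and let $\Delta_{\mathsf N}=\mathsf N_\star-S_{\mathsf N}$ be the homological operator. Put $$\bar{\mathsf M}=\sum_{i=1}^{p-1}\sum_{l=0}^{i-1}\mathsf N^{l}\mathsf M^{i}\mathsf N^{i-l-1},\qquad \bar S=\sum_{i=1}^{p-1}\sum_{l=0}^{i-1}S_{\mathsf N}^{\,l}\,S_{\mathsf M}^{\,i}\,S_{\mathsf N}^{\,i-l-1},\qquad \Delta_{\bar{\mathsf M}}=\bar{\mathsf M}_\star-\bar S .$$ Let $\mathcal P_k$ be the space of polynomial maps $\mathbb R^5\to\mathbb R^5$ that are homogeneous of degree $k+1$. A formal map $f=\mathsf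 Nx+\sum_{k\ge1}f_k$, $f_k\in\mathcal P_k$, is said to be in normal form in $\ker\Delta_{\bar{\mathsf M}}$-style if, for all $k\ge1$, $\mathcal P_k=\Delta_{\mathsf N}\mathcal P_k\oplus(\ker\Delta_{\bar{\mathsf M}}\cap\mathcal P_k)$ and $f_k\in\ker\Delta_{\bar{\mathsf M}}$. For polynomials $F^\bullet_\bullet,G^\bullet_\bullet$ with real coefficients in the indicated numbers of variables let $$\begin{aligned} T={}&\begin{pmatrix}0\\x_1x_2F_{1,2}^0(x_1,x_2,x_3,x_4,x_5)\\0\\0\\x_1x_2G_{1,2}^0(x_1,x_2,x_3,x_4,x_5)\end{pmatrix} +\begin{pmatrix}0\\x_1x_5F_{1,5}^0(x_1,x_3,x_4,x_5)\\0\\0\\x_1x_5G_{1,5}^0(x_1,x_3,x_4,x_5)\end{pmatrix} +\begin{pmatrix}0\\x_2x_3F_{2,3}^0(x_2,x_3,x_4,x_5)\\0\\0\\x_2x_3G_{2,3}^0(x_2,x_3,x_4,x_5)\end{pmatrix}\\ &+\begin{pmatrix}0\\x_3x_5F_{3,5}^0(x_3,x_4,x_5)\\0\\0\\x_3x_5G_{3,5}^0(x_3,x_4,x_5)\end{pmatrix}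 +\begin{pmatrix}0\\x_1F_1^0(x_1,x_3,x_4)\\0\\0\\x_1G_1^0(x_1,x_3,x_4)\end{pmatrix} +\begin{pmatrix}x_1F_1^1(x_1,x_3,x_4)\\x_2F_1^1(x_2,x_4,x_5)\\0\\\frac12x_1G_1^1(x_1,x_3,x_4)\\x_2G_1^1(x_2,x_4,x_5)\end{pmatrix} +\begin{pmatrix}0\\x_3x_4F_4^0(x_3,x_4)\\0\\0\\x_3x_4G_4^0(x_3,x_4)\end{pmatrix}\\ &+\begin{pmatrix}x_3x_4F_4^1(x_3,x_4)\\x_4x_5F_4^1(x_4,x_5)\\0\\\frac12x_3x_4G_4^1(x_3,x_4)\\x_4x_5G_4^1(x_4,x_5)\end{pmatrix} +\begin{pmatrix}0\\x_3F_3^0(x_3)\\0\\0\\x_3G_3^0(x_3)\end{pmatrix} +\begin{pmatrix}x_3F_3^1(x_3)\\\frac12x_4F_3^1(x_4)\\0\\\frac12x_3G_3^1(x_3)\\\frac12x_4G_3^1(x_4)\end{pmatrix} +\begin{pmatrix}0\\0\\\frac12x_3G_3^2(x_3)\\\frac12x_4G_3^2(x_4)\\\frac12x_5G_3^2(x_5)\end{pmatrix}.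 \end{aligned}$$ **Theorem.** 1. For every $k\ge0$, $\mathcal P_k=\Delta_{\mathsf N}\mathcal P_k\oplus(\ker\Delta_{\bar{\mathsf M}}\cap\mathcal P_k)$. 2. A polynomial map $F:\mathbb R^5\to\mathbb R^5$ satisfies $F(0)=0$ and $\Delta_{\bar{\mathsf M}}(F-\mathsf Nx)=0$ if and only if $F=\mathsf Nx+T$ for some polynomials $F^\bullet_\bullet,G^\bullet_\bullet$, and these polynomials are then uniquely determined by $F$. 3. A formal map $g$ with $g(0)=0$ and $Dg(0)=\mathsf N$ is in normal form in $\ker\Delta_{\bar{\mathsf M}}$-style if and only if each of its homogeneous parts of degree at least $2$ is of the form $T$, again for uniquely determined polynomials. 4. Every formal map $f$ with $f(0)=0$, $Df(0)=\mathsf N$ can be brought into this normal form: there is an invertible formal map $\varphi$ with $\varphi(0)=0$, $D\varphi(0)=I$ such that $\varphi\circ f\circ\varphi^{-1}$ is in normal form in $\ker\Delta_{\bar{\mathsf M}}$-style. -/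

import Mathlib

namespace MapNF

noncomputable section

/-- Polynomial maps `ℝⁿ → ℝⁿ`, i.e. `ℝ[x₁, …, xₙ] ⊗ ℝⁿ`. The variable `xᵢ` is `X (i - 1)`. -/
abbrev VecPoly (n : ℕ) : Type := Fin n → MvPolynomial (Fin n) ℝ

/-- Formal maps `ℝⁿ → ℝⁿ` (tuples of formal power series). -/
abbrev FormalMap (n : ℕ) : Type := Fin n → MvPowerSeries (Fin n) ℝ

/-- `𝒫ⁿₖ = P_{k+1} ⊗ ℝⁿ`: the polynomial maps all of whose components are homogeneous of
degree `k + 1`. -/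
def homogMaps (n k : ℕ) : Submodule ℝ (VecPoly n) :=
  Submodule.pi Set.univ fun _ => MvPolynomial.homogeneousSubmodule (Fin n) ℝ (k + 1)

/-- The linear map `x ↦ A x`, as a polynomial map. -/
def linMap {n : ℕ} (A : Matrix (Fin n) (Fin n) ℝ) : VecPoly n :=
  fun i => ∑ j, A i j • MvPolynomial.X j

/-- The multiplication operator `φ ↦ A φ(x)`. -/
def multOp {n : ℕ} (A : Matrix (Fin n) (Fin n) ℝ) : Module.End ℝ (VecPoly n) :=
  LinearMap.pi fun i => ∑ j, A i j • LinearMap.proj j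

/-- The substitution operator `φ ↦ φ(A x)`. -/
def subsOp {n : ℕ} (A : Matrix (Fin n) (Fin n) ℝ) : Module.End ℝ (VecPoly n) :=
  LinearMap.pi fun i => (MvPolynomial.aeval (linMap A)).toLinearMap ∘ₗ LinearMap.proj i

/-- The homological operator `φ ↦ A φ(x) - φ(A x)`. -/
def homologicalOp {n : ℕ} (A : Matrix (Fin n) (Fin n) ℝ) : Module.End ℝ (VecPoly n) :=
  multOp A - subsOp A

/-- `∑_{i=1}^{p-1} ∑_{l=0}^{i-1} aˡ bⁱ a^{i-l-1}`. -/
def barOf {R : Type*} [Ring R] (p : ℕ) (a b : R) : R :=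
  ∑ i ∈ Finset.Icc 1 (p - 1), ∑ l ∈ Finset.range i, a ^ l * b ^ i * a ^ (i - l - 1)

/-- For a nilpotent matrix `N` in Jordan normal form with transpose `M` and nilpotency index `p`:
the operator `φ ↦ M̄ φ - S̄ φ`, where `M̄ = ∑ Nˡ Mⁱ N^{i-l-1}` acts by multiplication and
`S̄ = ∑ S_Nˡ S_Mⁱ S_N^{i-l-1}` is built in the same way from the substitution operators
`S_N`, `S_M` (so `S̄` is not the substitution operator of `M̄`). -/
def homologicalBarOp {n : ℕ} (N : Matrix (Fin n) (Fin n) ℝ) : Module.End ℝ (VecPoly n) :=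
  multOp (barOf (nilpotencyClass N) N N.transpose)
    - barOf (nilpotencyClass N) (subsOp N) (subsOp N.transpose)

/-- The style `𝒞ₖ = ker (homologicalBarOp N) ∩ 𝒫ⁿₖ`. -/
def kerStyle {n : ℕ} (N : Matrix (Fin n) (Fin n) ℝ) (k : ℕ) : Submodule ℝ (VecPoly n) :=
  LinearMap.ker (homologicalBarOp N) ⊓ homogMaps n k

/-- `𝒫ⁿₖ = im (homologicalOp A) ⊕ C`, the operator being restricted to `𝒫ⁿₖ`. -/
def IsStyleAt {n : ℕ} (A : Matrix (Fin n) (Fin n) ℝ) (k : ℕ)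
    (C : Submodule ℝ (VecPoly n)) : Prop :=
  Disjoint ((homogMaps n k).map (homologicalOp A)) C ∧
    (homogMaps n k).map (homologicalOp A) ⊔ C = homogMaps n k

/-- The homogeneous part of degree `d` of a formal map. -/
def homogPart {n : ℕ} (d : ℕ) (f : FormalMap n) : VecPoly n :=
  fun i => MvPolynomial.homogeneousComponent d (MvPowerSeries.truncTotal (d + 1) (f i))

/-- `f(0) = 0` and `Df(0) = A`. -/
def HasLinearPart {n : ℕ} (A : Matrix (Fin n) (Fin n) ℝ) (f : FormalMap n) : Prop :=
  (∀ i, MvPowerSeries.constantCoeff (f i) = 0) ∧ homogPart 1 f = linMap A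

/-- Composition `f ∘ g` of formal maps (used for `g(0) = 0` only). -/
def comp {n : ℕ} (f g : FormalMap n) : FormalMap n :=
  fun i => MvPowerSeries.subst g (f i)

/-- `f = A x + f₁ + f₂ + …` with `fₖ ∈ 𝒫ⁿₖ` is in normal form with style `C` with respect to its
linear part `A`: for all `k ≥ 1`, `C k` is a complement to the image of the homological operator
in `𝒫ⁿₖ`, and `fₖ ∈ C k`. -/
def IsNormalForm {n : ℕ} (A : Matrix (Fin n) (Fin n) ℝ) (C : ℕ → Submodule ℝ (VecPoly n))
    (f : FormalMap n) : Prop :=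
  HasLinearPart A f ∧ ∀ k, 1 ≤ k → IsStyleAt A k (C k) ∧ homogPart (k + 1) f ∈ C k

/-- The nilpotent matrix in Jordan normal form with blocks of sizes 2 and 3. -/
def nilp23 : Matrix (Fin 5) (Fin 5) ℝ :=
  !![0, 1, 0, 0, 0;
     0, 0, 0, 0, 0;
     0, 0, 0, 1, 0;
     0, 0, 0, 0, 1;
     0, 0, 0, 0, 0]

/-- The arbitrary polynomials occurring in the normal form. -/
structure Params23 where
  (F12 G12 : MvPolynomial (Fin 5) ℝ)
  (F15 G15 F23 G23 : MvPolynomial (Fin 4) ℝ)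
  (F35 G35 : MvPolynomial (Fin 3) ℝ)
  (F1_0 G1_0 F1_1 G1_1 : MvPolynomial (Fin 3) ℝ)
  (F4_0 G4_0 F4_1 G4_1 : MvPolynomial (Fin 2) ℝ)
  (F3_0 G3_0 F3_1 G3_1 G3_2 : MvPolynomial (Fin 1) ℝ)

/-- `ev F ![y₁, …, yₘ]` is the polynomial `F(y₁, …, yₘ)`. -/
def ev {m : ℕ} (F : MvPolynomial (Fin m) ℝ) (v : Fin m → MvPolynomial (Fin 5) ℝ) :
    MvPolynomial (Fin 5) ℝ :=
  MvPolynomial.aeval v F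

/-- The sum of the families of terms of the normal form, without the linear part `N x`. -/
def terms23 (P : Params23) : VecPoly 5 :=
  let x₁ : MvPolynomial (Fin 5) ℝ := MvPolynomial.X 0
  let x₂ : MvPolynomial (Fin 5) ℝ := MvPolynomial.X 1
  let x₃ : MvPolynomial (Fin 5) ℝ := MvPolynomial.X 2
  let x₄ : MvPolynomial (Fin 5) ℝ := MvPolynomial.X 3
  let x₅ : MvPolynomial (Fin 5) ℝ := MvPolynomial.X 4
  let half : MvPolynomial (Fin 5) ℝ := MvPolynomial.C (1 / 2)
  ![0, x₁ * x₂ * ev P.F12 ![x₁, x₂, x₃, x₄, x₅], 0, 0, x₁ * x₂ * ev P.G12 ![x₁, x₂, x₃, x₄, x₅]]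
  + ![0, x₁ * x₅ * ev P.F15 ![x₁, x₃, x₄, x₅], 0, 0, x₁ * x₅ * ev P.G15 ![x₁, x₃, x₄, x₅]]
  + ![0, x₂ * x₃ * ev P.F23 ![x₂, x₃, x₄, x₅], 0, 0, x₂ * x₃ * ev P.G23 ![x₂, x₃, x₄, x₅]]
  + ![0, x₃ * x₅ * ev P.F35 ![x₃, x₄, x₅], 0, 0, x₃ * x₅ * ev P.G35 ![x₃, x₄, x₅]]
  + ![0, x₁ * ev P.F1_0 ![x₁, x₃, x₄], 0, 0, x₁ * ev P.G1_0 ![x₁, x₃, x₄]]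
  + ![x₁ * ev P.F1_1 ![x₁, x₃, x₄], x₂ * ev P.F1_1 ![x₂, x₄, x₅], 0,
      half * x₁ * ev P.G1_1 ![x₁, x₃, x₄], x₂ * ev P.G1_1 ![x₂, x₄, x₅]]
  + ![0, x₃ * x₄ * ev P.F4_0 ![x₃, x₄], 0, 0, x₃ * x₄ * ev P.G4_0 ![x₃, x₄]]
  + ![x₃ * x₄ * ev P.F4_1 ![x₃, x₄], x₄ * x₅ * ev P.F4_1 ![x₄, x₅], 0,
      half * x₃ * x₄ * ev P.G4_1 ![x₃, x₄], x₄ * x₅ * ev P.G4_1 ![x₄, x₅]]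
  + ![0, x₃ * ev P.F3_0 ![x₃], 0, 0, x₃ * ev P.G3_0 ![x₃]]
  + ![x₃ * ev P.F3_1 ![x₃], half * x₄ * ev P.F3_1 ![x₄], 0,
      half * x₃ * ev P.G3_1 ![x₃], half * x₄ * ev P.G3_1 ![x₄]]
  + ![0, 0, half * x₃ * ev P.G3_2 ![x₃], half * x₄ * ev P.G3_2 ![x₄],
      half * x₅ * ev P.G3_2 ![x₅]]

end

end MapNF

/-!
The operator `homologicalBarOp nilp23` is the adjoint of the homological operator `homologicalOp
nilp23` for a suitable inner product, and this makes its kernel a complement to the image.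

The substitution `p ↦ p(N x)` maps each non-constant monomial to a monomial or to zero, and so
moves the monomials along chains; `p ↦ p(Nᵀ x)` moves them backwards. The chains have length at
most three, and the non-constant monomials fall into eleven classes (`MonClass`) according to the
length of their chain and their position in it. Every polynomial is the sum of its constant term
and its parts in these classes (`MonClass.eq_C_add_sum_poly`), and on the parts
`p ↦ p(N x)` acts as a shift (`part_sN`), while the operator `sBar` built from both substitutions
shifts backwards (`part_sBar`) along the chains, with factor `1` on the chains of length two and factor `2` on
those of length three. With the square norms `1, 2, 4` along the chains of length three it is
adjoint to `p ↦ p(N x)` (`polyForm_sN`). The matrix part of `homologicalBarOp` has the same shape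
on the blocks of `N`, so the two operators are adjoint (`mapForm_homologicalOp`), and the
decomposition of the space of homogeneous maps follows by finite-dimensional linear algebra.

Among the maps vanishing at `0`, the kernel consists of the maps `φ` with `φ₁ = S̄ φ₂`,
`S̄² φ₂ = 0`, `2 φ₄ = S̄ φ₅`, `2 φ₃ = S̄ φ₄`; the last condition `S̄³ φ₅ = 0` holds automatically. Hence `φ₂` and `φ₅` determine `φ`, their
parts in the eleven classes are arbitrary except that the last one of `φ₂` vanishes, and these
parts are the parameters of the normal form (`terms23_paramsOf`, `paramsOf_terms23`).

A normalizing transformation `φ` and the normal form `g` of a formal map `f` are obtained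
together, as the limit (`exists_limit`) of approximate solutions of `φ ∘ f = g ∘ φ`. Adding
homogeneous terms `δ` to `φ` and `c` to `g` changes the lowest-degree part of `φ ∘ f - g ∘ φ` by
`-(homologicalOp N δ + c)` (`conj_step`), and any error can be removed in this way because the
kernel is a complement to the image. The inverse of `φ` is found by the same kind of iteration.
-/

namespace MapNF

noncomputable section

open MvPolynomial

/-! ### Decomposition of polynomials by classes of monomials -/

section Piece

variable {m : ℕ}

/-- The polynomial `xˢ F(x_{f 0}, …, x_{f (m-1)})`. -/
def piece (s : Fin 5 → ℕ) (f : Fin m → Fin 5) (F : MvPolynomial (Fin m) ℝ) :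
    MvPolynomial (Fin 5) ℝ :=
  monomial (Finsupp.equivFunOnFinite.symm s) 1 * rename f F

/-- The polynomial `F` in the variables `x_{f 0}, …, x_{f (m-1)}` for which `xˢ F` collects the
monomials of `p` of the form `xˢ` times a monomial in these variables. -/
def extract (s : Fin 5 → ℕ) {f : Fin m → Fin 5} (hf : f.Injective) :
    MvPolynomial (Fin 5) ℝ →ₗ[ℝ] MvPolynomial (Fin m) ℝ where
  toFun p := killCompl hf (p.divMonomial (Finsupp.equivFunOnFinite.symm s))
  map_add' p q := by rw [add_divMonomial, map_add]
  map_smul' c p := by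
    ext u
    simp [coeff_killCompl, coeff_divMonomial]

theorem coeff_extract (s : Fin 5 → ℕ) {f : Fin m → Fin 5} (hf : f.Injective)
    (p : MvPolynomial (Fin 5) ℝ) (u : Fin m →₀ ℕ) :
    coeff u (extract s hf p) = coeff (Finsupp.equivFunOnFinite.symm s + u.mapDomain f) p := by
  simp [extract, coeff_killCompl, coeff_divMonomial]

theorem extract_piece (s : Fin 5 → ℕ) {f : Fin m → Fin 5} (hf : f.Injective)
    (F : MvPolynomial (Fin m) ℝ) : extract s hf (piece s f F) = F := by
  simp [extract, piece]

/-- The monomials occurring in polynomials of the form `piece s f F`. -/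
def InClass (s : Fin 5 → ℕ) (f : Fin m → Fin 5) (d : Fin 5 →₀ ℕ) : Prop :=
  ∀ i, s i ≤ d i ∧ ((∀ j, f j ≠ i) → d i = s i)

theorem inClass_add_mapDomain (s : Fin 5 → ℕ) (f : Fin m → Fin 5) (u : Fin m →₀ ℕ) :
    InClass s f (Finsupp.equivFunOnFinite.symm s + u.mapDomain f) := by
  intro i
  refine ⟨by simp, fun h => ?_⟩
  have : (u.mapDomain f) i = 0 := Finsupp.mapDomain_of_notMem_range _ _ (by simpa using h)
  simp [this]

theorem InClass.exists_eq {s : Fin 5 → ℕ} {f : Fin m → Fin 5} (hf : f.Injective)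
    {d : Fin 5 →₀ ℕ} (h : InClass s f d) :
    ∃ u : Fin m →₀ ℕ, d = Finsupp.equivFunOnFinite.symm s + u.mapDomain f := by
  have hs : Finsupp.equivFunOnFinite.symm s ≤ d := fun i => (h i).1
  refine ⟨(d - Finsupp.equivFunOnFinite.symm s).comapDomain f hf.injOn, ?_⟩
  rw [Finsupp.mapDomain_comapDomain f hf, add_tsub_cancel_of_le hs]
  intro i hi
  by_contra hr
  have := (h i).2 (by simpa using hr)
  simp [this] at hi

theorem coeff_piece_eq_zero (s : Fin 5 → ℕ) {f : Fin m → Fin 5}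
    (F : MvPolynomial (Fin m) ℝ) {d : Fin 5 →₀ ℕ} (h : ¬ InClass s f d) :
    coeff d (piece s f F) = 0 := by
  rw [piece, coeff_monomial_mul']
  split_ifs with hs
  · rw [one_mul]
    refine coeff_rename_eq_zero _ _ _ fun u hu => (h ?_).elim
    have := inClass_add_mapDomain s f u
    rwa [hu, add_tsub_cancel_of_le hs] at this
  · rfl

theorem coeff_piece_extract (s : Fin 5 → ℕ) {f : Fin m → Fin 5} (hf : f.Injective)
    (p : MvPolynomial (Fin 5) ℝ) {d : Fin 5 →₀ ℕ} (h : InClass s f d) :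
    coeff d (piece s f (extract s hf p)) = coeff d p := by
  obtain ⟨u, rfl⟩ := h.exists_eq hf
  rw [← coeff_extract s hf, extract_piece, coeff_extract]

theorem extract_piece_eq_zero {m' : ℕ} {s s' : Fin 5 → ℕ} {f : Fin m → Fin 5} (hf : f.Injective)
    {f' : Fin m' → Fin 5} (h : ∀ d, InClass s f d → ¬ InClass s' f' d)
    (F : MvPolynomial (Fin m') ℝ) : extract s hf (piece s' f' F) = 0 := by
  ext u
  rw [coeff_extract, coeff_piece_eq_zero _ _ (h _ (inClass_add_mapDomain s f u)), coeff_zero]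

end Piece

/-- The classes of non-constant monomials in `x₁, …, x₅`, according to their position in the
chains `x^α ↦ (N x)^α` of monomials: `c12`, `c15`, `c23`, `c35` are the chains of length one,
`c1_0 → c1_1` and `c4_0 → c4_1` the chains of length two and `c3_0 → c3_1 → c3_2` those of length
three. -/
inductive MonClass
  | c12 | c15 | c23 | c35 | c1_0 | c1_1 | c4_0 | c4_1 | c3_0 | c3_1 | c3_2
  deriving DecidableEq

namespace MonClass

instance : Fintype MonClass where
  elems := {c12, c15, c23, c35, c1_0, c1_1, c4_0, c4_1, c3_0, c3_1, c3_2}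
  complete c := by cases c <;> decide

/-- The number of variables that occur freely in the monomials of a class. It is reducible because
the operators on parts identify the types `Fin c.arity` for the classes `c` of one chain. -/
abbrev arity : MonClass → ℕ
  | c12 => 5
  | c15 | c23 => 4
  | c35 | c1_0 | c1_1 => 3
  | c4_0 | c4_1 => 2
  | c3_0 | c3_1 | c3_2 => 1

/-- The monomial that divides all monomials of a class. -/
def expo : MonClass → Fin 5 → ℕ
  | c12 => ![1, 1, 0, 0, 0]
  | c15 => ![1, 0, 0, 0, 1]
  | c23 => ![0, 1, 1, 0, 0]
  | c35 => ![0, 0, 1, 0, 1]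
  | c1_0 => ![1, 0, 0, 0, 0]
  | c1_1 => ![0, 1, 0, 0, 0]
  | c4_0 => ![0, 0, 1, 1, 0]
  | c4_1 => ![0, 0, 0, 1, 1]
  | c3_0 => ![0, 0, 1, 0, 0]
  | c3_1 => ![0, 0, 0, 1, 0]
  | c3_2 => ![0, 0, 0, 0, 1]

/-- The variables that occur freely in the monomials of a class. -/
def var : (c : MonClass) → Fin c.arity → Fin 5
  | c12 => ![0, 1, 2, 3, 4]
  | c15 => ![0, 2, 3, 4]
  | c23 => ![1, 2, 3, 4]
  | c35 => ![2, 3, 4]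
  | c1_0 => ![0, 2, 3]
  | c1_1 => ![1, 3, 4]
  | c4_0 => ![2, 3]
  | c4_1 => ![3, 4]
  | c3_0 => ![2]
  | c3_1 => ![3]
  | c3_2 => ![4]

theorem var_injective (c : MonClass) : c.var.Injective := by
  cases c <;> decide

/-- Membership of a monomial in a class. -/
def Mem (c : MonClass) (d : Fin 5 →₀ ℕ) : Prop := InClass c.expo c.var d

theorem sum_eq {M : Type*} [AddCommMonoid M] (g : MonClass → M) :
    ∑ c, g c = g c12 + g c15 + g c23 + g c35 + g c1_0 + g c1_1 + g c4_0 + g c4_1 + g c3_0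
      + g c3_1 + g c3_2 := by
  have : (Finset.univ : Finset MonClass) =
    {c12, c15, c23, c35, c1_0, c1_1, c4_0, c4_1, c3_0, c3_1, c3_2} := rfl
  rw [this]
  simp [Finset.sum_insert, add_assoc]

/-- Membership in a class in terms of which exponents vanish. -/
theorem mem_iff (c : MonClass) (d : Fin 5 →₀ ℕ) : c.Mem d ↔
    match c with
    | c12 => d 0 ≠ 0 ∧ d 1 ≠ 0
    | c15 => d 0 ≠ 0 ∧ d 1 = 0 ∧ d 4 ≠ 0
    | c23 => d 0 = 0 ∧ d 1 ≠ 0 ∧ d 2 ≠ 0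
    | c35 => d 0 = 0 ∧ d 1 = 0 ∧ d 2 ≠ 0 ∧ d 4 ≠ 0
    | c1_0 => d 0 ≠ 0 ∧ d 1 = 0 ∧ d 4 = 0
    | c1_1 => d 0 = 0 ∧ d 1 ≠ 0 ∧ d 2 = 0
    | c4_0 => d 0 = 0 ∧ d 1 = 0 ∧ d 2 ≠ 0 ∧ d 3 ≠ 0 ∧ d 4 = 0
    | c4_1 => d 0 = 0 ∧ d 1 = 0 ∧ d 2 = 0 ∧ d 3 ≠ 0 ∧ d 4 ≠ 0
    | c3_0 => d 0 = 0 ∧ d 1 = 0 ∧ d 2 ≠ 0 ∧ d 3 = 0 ∧ d 4 = 0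
    | c3_1 => d 0 = 0 ∧ d 1 = 0 ∧ d 2 = 0 ∧ d 3 ≠ 0 ∧ d 4 = 0
    | c3_2 => d 0 = 0 ∧ d 1 = 0 ∧ d 2 = 0 ∧ d 3 = 0 ∧ d 4 ≠ 0 := by
  cases c <;>
  · simp [Mem, InClass, expo, var, arity, Fin.forall_fin_succ, Nat.one_le_iff_ne_zero]
    try grind

theorem exists_mem {d : Fin 5 →₀ ℕ} (hd : d ≠ 0) : ∃ c : MonClass, c.Mem d := by
  by_contra! h
  apply hd
  have h12 := h c12
  have h15 := h c15
  have h23 := h c23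
  have h35 := h c35
  have h1_0 := h c1_0
  have h1_1 := h c1_1
  have h4_0 := h c4_0
  have h4_1 := h c4_1
  have h3_0 := h c3_0
  have h3_1 := h c3_1
  have h3_2 := h c3_2
  simp only [mem_iff] at h12 h15 h23 h35 h1_0 h1_1 h4_0 h4_1 h3_0 h3_1 h3_2
  ext i
  fin_cases i <;> simp <;> grind

theorem Mem.eq {c c' : MonClass} {d : Fin 5 →₀ ℕ} (h : c.Mem d) (h' : c'.Mem d) : c = c' := by
  rw [mem_iff] at h h'
  cases c <;> cases c' <;> first | rfl | (exfalso; simp only at h h'; grind)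

theorem not_mem_zero (c : MonClass) : ¬ c.Mem 0 := by
  rw [mem_iff]
  cases c <;> simp

/-- The polynomial whose monomials are those of the class `c`, with coefficients given by `F`. -/
def poly (c : MonClass) (F : MvPolynomial (Fin c.arity) ℝ) : MvPolynomial (Fin 5) ℝ :=
  piece c.expo c.var F

/-- The part of a polynomial that consists of the monomials of the class `c`, as a polynomial in
the free variables of this class. -/
def part (c : MonClass) : MvPolynomial (Fin 5) ℝ →ₗ[ℝ] MvPolynomial (Fin c.arity) ℝ :=
  extract c.expo c.var_injective

theorem part_poly (c : MonClass) (F : MvPolynomial (Fin c.arity) ℝ) : c.part (c.poly F) = F :=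
  extract_piece _ _ _

theorem part_poly_of_ne {c c' : MonClass} (h : c ≠ c') (F : MvPolynomial (Fin c'.arity) ℝ) :
    c.part (c'.poly F) = 0 :=
  extract_piece_eq_zero _ (fun _ hd hd' => h (Mem.eq hd hd')) _

theorem part_C (c : MonClass) (r : ℝ) : c.part (C r) = 0 := by
  ext u
  rw [part, coeff_extract, coeff_C, if_neg, coeff_zero]
  intro h
  exact c.not_mem_zero (h ▸ inClass_add_mapDomain c.expo c.var u)

theorem coeff_poly_of_not_mem {c : MonClass} {d : Fin 5 →₀ ℕ} (h : ¬ c.Mem d)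
    (F : MvPolynomial (Fin c.arity) ℝ) : coeff d (c.poly F) = 0 :=
  coeff_piece_eq_zero _ _ h

/-- Every polynomial is the sum of its constant term and of its parts in the eleven classes. -/
theorem eq_C_add_sum_poly (p : MvPolynomial (Fin 5) ℝ) :
    p = C (constantCoeff p) + ∑ c : MonClass, c.poly (c.part p) := by
  ext d
  rw [coeff_add, coeff_sum, coeff_C]
  by_cases hd : d = 0
  · subst hd
    rw [if_pos rfl, Finset.sum_eq_zero fun c _ => coeff_poly_of_not_mem c.not_mem_zero _, add_zero]
    rfl
  · obtain ⟨c, hc⟩ := exists_mem hd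
    rw [if_neg (Ne.symm hd), zero_add, Finset.sum_eq_single c]
    · exact (coeff_piece_extract _ _ _ hc).symm
    · exact fun c' _ h => coeff_poly_of_not_mem (fun hc' => h (hc'.eq hc)) _
    · simp

theorem part_sum_poly (F : (c : MonClass) → MvPolynomial (Fin c.arity) ℝ) (c : MonClass) :
    c.part (∑ c' : MonClass, c'.poly (F c')) = F c := by
  rw [map_sum, Finset.sum_eq_single c, part_poly]
  · exact fun c' _ h => part_poly_of_ne (Ne.symm h) _
  · simp

theorem poly_eq_prod_mul_aeval (c : MonClass) (F : MvPolynomial (Fin c.arity) ℝ) :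
    c.poly F = (∏ i, X i ^ c.expo i) * aeval (fun j => X (c.var j)) F := by
  rw [poly, piece, rename_eq_aeval, monomial_eq, C_1, one_mul, Finsupp.prod_fintype _ _ (by simp)]
  rfl

theorem poly_eq_mul_ev (c : MonClass) (F : MvPolynomial (Fin c.arity) ℝ)
    {q : MvPolynomial (Fin 5) ℝ} {v : Fin c.arity → MvPolynomial (Fin 5) ℝ}
    (hq : ∏ i, X i ^ c.expo i = q) (hv : ∀ j, X (c.var j) = v j) :
    c.poly F = q * ev F v := by
  rw [poly_eq_prod_mul_aeval, hq, ev, funext hv]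

theorem poly_c12 (F : MvPolynomial (Fin 5) ℝ) :
    c12.poly F = X 0 * X 1 * ev F ![X 0, X 1, X 2, X 3, X 4] :=
  poly_eq_mul_ev c12 F (by simp [expo, Fin.prod_univ_five]) fun j => by
    fin_cases j <;> rfl

theorem poly_c15 (F : MvPolynomial (Fin 4) ℝ) :
    c15.poly F = X 0 * X 4 * ev F ![X 0, X 2, X 3, X 4] :=
  poly_eq_mul_ev c15 F (by simp [expo, Fin.prod_univ_five]) fun j => by
    fin_cases j <;> rfl

theorem poly_c23 (F : MvPolynomial (Fin 4) ℝ) :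
    c23.poly F = X 1 * X 2 * ev F ![X 1, X 2, X 3, X 4] :=
  poly_eq_mul_ev c23 F (by simp [expo, Fin.prod_univ_five]) fun j => by
    fin_cases j <;> rfl

theorem poly_c35 (F : MvPolynomial (Fin 3) ℝ) :
    c35.poly F = X 2 * X 4 * ev F ![X 2, X 3, X 4] :=
  poly_eq_mul_ev c35 F (by simp [expo, Fin.prod_univ_five]) fun j => by
    fin_cases j <;> rfl

theorem poly_c1_0 (F : MvPolynomial (Fin 3) ℝ) :
    c1_0.poly F = X 0 * ev F ![X 0, X 2, X 3] :=
  poly_eq_mul_ev c1_0 F (by simp [expo, Fin.prod_univ_five]) fun j => by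
    fin_cases j <;> rfl

theorem poly_c1_1 (F : MvPolynomial (Fin 3) ℝ) :
    c1_1.poly F = X 1 * ev F ![X 1, X 3, X 4] :=
  poly_eq_mul_ev c1_1 F (by simp [expo, Fin.prod_univ_five]) fun j => by
    fin_cases j <;> rfl

theorem poly_c4_0 (F : MvPolynomial (Fin 2) ℝ) :
    c4_0.poly F = X 2 * X 3 * ev F ![X 2, X 3] :=
  poly_eq_mul_ev c4_0 F (by simp [expo, Fin.prod_univ_five]) fun j => by
    fin_cases j <;> rfl

theorem poly_c4_1 (F : MvPolynomial (Fin 2) ℝ) :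
    c4_1.poly F = X 3 * X 4 * ev F ![X 3, X 4] :=
  poly_eq_mul_ev c4_1 F (by simp [expo, Fin.prod_univ_five]) fun j => by
    fin_cases j <;> rfl

theorem poly_c3_0 (F : MvPolynomial (Fin 1) ℝ) :
    c3_0.poly F = X 2 * ev F ![X 2] :=
  poly_eq_mul_ev c3_0 F (by simp [expo, Fin.prod_univ_five]) fun j => by
    fin_cases j; rfl

theorem poly_c3_1 (F : MvPolynomial (Fin 1) ℝ) :
    c3_1.poly F = X 3 * ev F ![X 3] :=
  poly_eq_mul_ev c3_1 F (by simp [expo, Fin.prod_univ_five]) fun j => by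
    fin_cases j; rfl

theorem poly_c3_2 (F : MvPolynomial (Fin 1) ℝ) :
    c3_2.poly F = X 4 * ev F ![X 4] :=
  poly_eq_mul_ev c3_2 F (by simp [expo, Fin.prod_univ_five]) fun j => by
    fin_cases j; rfl

end MonClass

open MonClass

/-! ### The substitution operators and the chains of monomials -/

/-- The substitution `p ↦ p(N x)` on polynomials. -/
def sN : MvPolynomial (Fin 5) ℝ →ₐ[ℝ] MvPolynomial (Fin 5) ℝ := aeval (linMap nilp23)

/-- The substitution `p ↦ p(Nᵀ x)` on polynomials. -/
def sM : MvPolynomial (Fin 5) ℝ →ₐ[ℝ] MvPolynomial (Fin 5) ℝ := aeval (linMap nilp23.transpose)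

/-- The operator built from `sN` and `sM` by which the substitution part of `homologicalBarOp`
acts on each component. -/
def sBar : Module.End ℝ (MvPolynomial (Fin 5) ℝ) := barOf 3 sN.toLinearMap sM.toLinearMap

theorem linMap_nilp23 : linMap nilp23 = ![X 1, 0, X 3, X 4, 0] := by
  funext i
  fin_cases i <;> simp [linMap, nilp23, Fin.sum_univ_five]

theorem linMap_nilp23_transpose : linMap nilp23.transpose = ![0, X 0, 0, X 2, X 3] := by
  funext i
  fin_cases i <;> simp [linMap, nilp23, Fin.sum_univ_five]

theorem barOf_three {R : Type*} [Ring R] (a b : R) :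
    barOf 3 a b = b + (b ^ 2 * a + a * b ^ 2) := by
  have : Finset.Icc 1 (3 - 1) = {1, 2} := rfl
  simp [barOf, this, Finset.sum_range_succ]

theorem sBar_apply (p : MvPolynomial (Fin 5) ℝ) :
    sBar p = sM p + (sM (sM (sN p)) + sN (sM (sM p))) := by
  simp [sBar, barOf_three, pow_two]

theorem map_ev {m : ℕ} (φ : MvPolynomial (Fin 5) ℝ →ₐ[ℝ] MvPolynomial (Fin 5) ℝ)
    (F : MvPolynomial (Fin m) ℝ) (v : Fin m → MvPolynomial (Fin 5) ℝ) :
    φ (ev F v) = ev F (φ ∘ v) := by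
  rw [ev, ev, ← AlgHom.comp_apply, comp_aeval]
  rfl

theorem comp_vecCons {α β : Type*} {m : ℕ} (g : α → β) (x : α) (v : Fin m → α) :
    g ∘ Matrix.vecCons x v = Matrix.vecCons (g x) (g ∘ v) :=
  Fin.comp_cons g x v

theorem comp_vecEmpty {α β : Type*} (g : α → β) (v : Fin 0 → α) : g ∘ v = ![] :=
  Subsingleton.elim _ _

theorem sN_X (i : Fin 5) : sN (X i) = ![X 1, 0, X 3, X 4, 0] i := by
  rw [sN, aeval_X, linMap_nilp23]

theorem sM_X (i : Fin 5) : sM (X i) = ![0, X 0, 0, X 2, X 3] i := by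
  rw [sM, aeval_X, linMap_nilp23_transpose]

/-- The effect of `sN` on the parts of a polynomial in the eleven classes: a shift along the
chains. -/
def shiftN (F : (c : MonClass) → MvPolynomial (Fin c.arity) ℝ) :
    (c : MonClass) → MvPolynomial (Fin c.arity) ℝ
  | c1_1 => F c1_0
  | c4_1 => F c4_0
  | c3_1 => F c3_0
  | c3_2 => F c3_1
  | c12 | c15 | c23 | c35 | c1_0 | c4_0 | c3_0 => 0

/-- The effect of `sBar` on the parts of a polynomial in the eleven classes: the opposite shift,
doubled on the chains of length three. -/
def shiftBar (F : (c : MonClass) → MvPolynomial (Fin c.arity) ℝ) :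
    (c : MonClass) → MvPolynomial (Fin c.arity) ℝ
  | c1_0 => F c1_1
  | c4_0 => F c4_1
  | c3_0 => (2 : ℝ) • F c3_1
  | c3_1 => (2 : ℝ) • F c3_2
  | c12 | c15 | c23 | c35 | c1_1 | c4_1 | c3_2 => 0

theorem poly_zero (c : MonClass) : c.poly 0 = 0 := by
  rw [poly, piece, map_zero, mul_zero]

theorem ev_smul {m : ℕ} (r : ℝ) (F : MvPolynomial (Fin m) ℝ) (v : Fin m → MvPolynomial (Fin 5) ℝ) :
    ev (r • F) v = C r * ev F v := by
  rw [ev, map_smul, smul_eq_C_mul, ev]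

theorem sN_eq (p : MvPolynomial (Fin 5) ℝ) :
    sN p = C (constantCoeff p) + ∑ c : MonClass, c.poly (shiftN (fun c => c.part p) c) := by
  conv_lhs => rw [eq_C_add_sum_poly p]
  simp only [sum_eq]
  simp [shiftN, poly_zero, poly_c12, poly_c15, poly_c23, poly_c35, poly_c1_0, poly_c1_1, poly_c4_0,
    poly_c4_1, poly_c3_0, poly_c3_1, poly_c3_2, map_ev, comp_vecCons, comp_vecEmpty, sN_X]

theorem sBar_eq (p : MvPolynomial (Fin 5) ℝ) :
    sBar p = C (3 * constantCoeff p) + ∑ c : MonClass, c.poly (shiftBar (fun c => c.part p) c) := by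
  conv_lhs => rw [eq_C_add_sum_poly p]
  simp only [sum_eq]
  simp [shiftBar, poly_zero, sBar_apply, poly_c12, poly_c15, poly_c23, poly_c35, poly_c1_0,
    poly_c1_1, poly_c4_0, poly_c4_1, poly_c3_0, poly_c3_1, poly_c3_2, map_ev, ev_smul, comp_vecCons,
    comp_vecEmpty, sN_X, sM_X,
    show (C 2 : MvPolynomial (Fin 5) ℝ) = 2 from map_ofNat C 2,
    show (C 3 : MvPolynomial (Fin 5) ℝ) = 3 from map_ofNat C 3]
  ring

theorem part_sN (p : MvPolynomial (Fin 5) ℝ) (c : MonClass) :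
    c.part (sN p) = shiftN (fun c => c.part p) c := by
  rw [sN_eq, map_add, part_C, zero_add, part_sum_poly]

theorem part_sBar (p : MvPolynomial (Fin 5) ℝ) (c : MonClass) :
    c.part (sBar p) = shiftBar (fun c => c.part p) c := by
  rw [sBar_eq, map_add, part_C, zero_add, part_sum_poly]

theorem constantCoeff_poly (c : MonClass) (F : MvPolynomial (Fin c.arity) ℝ) :
    constantCoeff (c.poly F) = 0 :=
  coeff_poly_of_not_mem c.not_mem_zero F

theorem sBar_sum_poly (F : (c : MonClass) → MvPolynomial (Fin c.arity) ℝ) :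
    sBar (∑ c : MonClass, c.poly (F c)) = ∑ c : MonClass, c.poly (shiftBar F c) := by
  rw [sBar_eq, map_sum, Finset.sum_eq_zero fun c _ => constantCoeff_poly c _, mul_zero, C_0,
    zero_add]
  simp only [part_sum_poly]

theorem nilp23_transpose : nilp23.transpose =
    !![0, 0, 0, 0, 0;
       1, 0, 0, 0, 0;
       0, 0, 0, 0, 0;
       0, 0, 1, 0, 0;
       0, 0, 0, 1, 0] := by
  ext i j
  fin_cases i <;> fin_cases j <;> rfl

theorem nilp23_sq : nilp23 ^ 2 =
    !![0, 0, 0, 0, 0;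
       0, 0, 0, 0, 0;
       0, 0, 0, 0, 1;
       0, 0, 0, 0, 0;
       0, 0, 0, 0, 0] := by
  simp [nilp23, pow_two]
  funext i
  fin_cases i <;> rfl

theorem nilp23_transpose_sq : nilp23.transpose ^ 2 =
    !![0, 0, 0, 0, 0;
       0, 0, 0, 0, 0;
       0, 0, 0, 0, 0;
       0, 0, 0, 0, 0;
       0, 0, 1, 0, 0] := by
  simp [nilp23_transpose, pow_two]
  funext i
  fin_cases i <;> rfl

theorem nilpotencyClass_nilp23 : nilpotencyClass nilp23 = 3 := by
  rw [nilpotencyClass_eq_succ_iff]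
  constructor
  · rw [pow_succ, nilp23_sq, nilp23]
    ext i j
    fin_cases i <;> fin_cases j <;> simp
  · intro h
    have := congrFun (congrFun h 2) 4
    rw [nilp23_sq] at this
    simp at this

theorem barOf_nilp23 : barOf 3 nilp23 nilp23.transpose =
    !![0, 0, 0, 0, 0;
       1, 0, 0, 0, 0;
       0, 0, 0, 0, 0;
       0, 0, 2, 0, 0;
       0, 0, 0, 2, 0] := by
  rw [barOf_three, nilp23_transpose_sq, nilp23_transpose, nilp23]
  norm_num

theorem homologicalOp_nilp23 (φ : VecPoly 5) : homologicalOp nilp23 φ =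
    ![φ 1 - sN (φ 0), - sN (φ 1), φ 3 - sN (φ 2), φ 4 - sN (φ 3), - sN (φ 4)] := by
  funext i
  fin_cases i <;> simp [homologicalOp, multOp, subsOp, nilp23, Fin.sum_univ_five, sN]

theorem barOf_subsOp_apply (φ : VecPoly 5) (i : Fin 5) :
    barOf 3 (subsOp nilp23) (subsOp nilp23.transpose) φ i = sBar (φ i) := by
  rw [barOf_three, sBar_apply]
  simp [pow_two, subsOp, sN, sM]

theorem homologicalBarOp_nilp23 (φ : VecPoly 5) : homologicalBarOp nilp23 φ =
    ![- sBar (φ 0), φ 0 - sBar (φ 1), - sBar (φ 2), (2 : ℝ) • φ 2 - sBar (φ 3),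
      (2 : ℝ) • φ 3 - sBar (φ 4)] := by
  funext i
  rw [homologicalBarOp, nilpotencyClass_nilp23, barOf_nilp23, LinearMap.sub_apply, Pi.sub_apply,
    barOf_subsOp_apply]
  fin_cases i <;> simp [multOp, Fin.sum_univ_five]

/-! ### The inner product and the complement of the image -/

section Coeff

variable {σ : Type*}

/-- The bilinear form on polynomials for which the monomials are orthonormal. -/
def coeffForm : LinearMap.BilinForm ℝ (MvPolynomial σ ℝ) :=
  (basisMonomials σ ℝ).constr ℝ fun d => lcoeff ℝ d

theorem coeffForm_apply (p q : MvPolynomial σ ℝ) :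
    coeffForm p q = ∑ d ∈ p.support, coeff d p * coeff d q := by
  rw [coeffForm, Module.Basis.constr_apply, Finsupp.sum, LinearMap.sum_apply]
  rfl

theorem coeffForm_comm (p q : MvPolynomial σ ℝ) : coeffForm p q = coeffForm q p := by
  classical
  have key (p q : MvPolynomial σ ℝ) :
      coeffForm p q = ∑ d ∈ p.support ∪ q.support, coeff d p * coeff d q := by
    rw [coeffForm_apply]
    refine Finset.sum_subset Finset.subset_union_left fun d _ hd => ?_
    rw [notMem_support_iff.mp hd, zero_mul]
  rw [key, key, Finset.union_comm]
  exact Finset.sum_congr rfl fun d _ => mul_comm _ _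

theorem coeffForm_self_nonneg (p : MvPolynomial σ ℝ) : 0 ≤ coeffForm p p := by
  rw [coeffForm_apply]
  exact Finset.sum_nonneg fun d _ => mul_self_nonneg _

theorem coeffForm_self_eq_zero {p : MvPolynomial σ ℝ} (h : coeffForm p p = 0) : p = 0 := by
  rw [coeffForm_apply, Finset.sum_eq_zero_iff_of_nonneg fun d _ => mul_self_nonneg _] at h
  by_contra hp
  obtain ⟨d, hd⟩ := support_nonempty.mpr hp
  exact mem_support_iff.mp hd (mul_self_eq_zero.mp (h d hd))

end Coeff

/-- The square of the norm of a monomial, as a function of its class. -/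
def MonClass.weight : MonClass → ℝ
  | c3_1 => 2
  | c3_2 => 4
  | _ => 1

theorem MonClass.weight_pos (c : MonClass) : 0 < c.weight := by
  cases c <;> norm_num [weight]

/-- The bilinear form on polynomials for which the non-constant monomials are orthogonal with
square norms given by `MonClass.weight`, and constants are orthogonal to everything. -/
def polyForm : LinearMap.BilinForm ℝ (MvPolynomial (Fin 5) ℝ) :=
  ∑ c : MonClass, c.weight • coeffForm.compl₁₂ c.part c.part

theorem polyForm_apply (p q : MvPolynomial (Fin 5) ℝ) :
    polyForm p q = ∑ c : MonClass, c.weight * coeffForm (c.part p) (c.part q) := by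
  simp [polyForm, LinearMap.sum_apply]

theorem polyForm_comm (p q : MvPolynomial (Fin 5) ℝ) : polyForm p q = polyForm q p := by
  simp only [polyForm_apply, coeffForm_comm (part _ p)]

theorem polyForm_self_nonneg (p : MvPolynomial (Fin 5) ℝ) : 0 ≤ polyForm p p := by
  rw [polyForm_apply]
  exact Finset.sum_nonneg fun c _ => mul_nonneg c.weight_pos.le (coeffForm_self_nonneg _)

theorem polyForm_self_eq_zero {p : MvPolynomial (Fin 5) ℝ} (hp : constantCoeff p = 0)
    (h : polyForm p p = 0) : p = 0 := by
  rw [polyForm_apply, Finset.sum_eq_zero_iff_of_nonneg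
    fun c _ => mul_nonneg c.weight_pos.le (coeffForm_self_nonneg _)] at h
  rw [eq_C_add_sum_poly p, hp, C_0, zero_add]
  refine Finset.sum_eq_zero fun c _ => ?_
  rw [coeffForm_self_eq_zero ((mul_eq_zero.mp (h c (Finset.mem_univ c))).resolve_left
    c.weight_pos.ne'), poly, piece, map_zero, mul_zero]

/-- `sBar` is the adjoint of `sN`: this is how the weights are chosen. -/
theorem polyForm_sN (p q : MvPolynomial (Fin 5) ℝ) : polyForm (sN p) q = polyForm p (sBar q) := by
  simp only [polyForm_apply, part_sN, part_sBar, sum_eq, shiftN, shiftBar, weight, map_zero,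
    map_smul, LinearMap.zero_apply, smul_eq_mul]
  ring

/-- The square norms of the coordinates of `ℝ⁵`. -/
def coordWeight : Fin 5 → ℝ := ![1, 1, 4, 2, 1]

theorem coordWeight_pos (i : Fin 5) : 0 < coordWeight i := by
  fin_cases i <;> norm_num [coordWeight]

/-- The bilinear form on polynomial maps that makes `homologicalBarOp nilp23` the adjoint of
`homologicalOp nilp23`; it is positive definite on the maps vanishing at `0`. -/
def mapForm : LinearMap.BilinForm ℝ (VecPoly 5) :=
  ∑ i, coordWeight i • polyForm.compl₁₂ (LinearMap.proj i) (LinearMap.proj i)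

theorem mapForm_apply (φ ψ : VecPoly 5) :
    mapForm φ ψ = ∑ i, coordWeight i * polyForm (φ i) (ψ i) := by
  simp [mapForm, LinearMap.sum_apply]

theorem mapForm_comm (φ ψ : VecPoly 5) : mapForm φ ψ = mapForm ψ φ := by
  simp only [mapForm_apply, polyForm_comm (φ _)]

theorem mapForm_self_eq_zero {φ : VecPoly 5} (hφ : ∀ i, constantCoeff (φ i) = 0)
    (h : mapForm φ φ = 0) : φ = 0 := by
  rw [mapForm_apply, Finset.sum_eq_zero_iff_of_nonneg
    fun i _ => mul_nonneg (coordWeight_pos i).le (polyForm_self_nonneg _)] at h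
  funext i
  exact polyForm_self_eq_zero (hφ i) ((mul_eq_zero.mp (h i (Finset.mem_univ i))).resolve_left
    (coordWeight_pos i).ne')

theorem mapForm_homologicalOp (φ ψ : VecPoly 5) :
    mapForm (homologicalOp nilp23 φ) ψ = mapForm φ (homologicalBarOp nilp23 ψ) := by
  rw [homologicalOp_nilp23, homologicalBarOp_nilp23]
  simp [mapForm_apply, Fin.sum_univ_five, coordWeight, polyForm_sN]
  ring

/-- If `T'` is adjoint to `T` for a symmetric bilinear form that is anisotropic on a
finite-dimensional subspace `P` invariant under both, then `P` is the direct sum of `T P` and of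
the kernel of `T'` in `P`. -/
theorem _root_.LinearMap.BilinForm.disjoint_and_sup_ker_of_adjoint {V : Type*} [AddCommGroup V]
    [Module ℝ V] (B : LinearMap.BilinForm ℝ V) (hB : ∀ x y, B x y = B y x) (P : Submodule ℝ V)
    [FiniteDimensional ℝ P] (hP : ∀ x ∈ P, B x x = 0 → x = 0) {T T' : Module.End ℝ V}
    (hT : ∀ x ∈ P, T x ∈ P) (hT' : ∀ x ∈ P, T' x ∈ P) (hadj : ∀ x y, B (T x) y = B x (T' y)) :
    Disjoint (P.map T) (LinearMap.ker T' ⊓ P) ∧ P.map T ⊔ LinearMap.ker T' ⊓ P = P := by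
  have hdisj : Disjoint (P.map T) (LinearMap.ker T' ⊓ P) := by
    rw [Submodule.disjoint_def]
    rintro _ ⟨x, -, rfl⟩ ⟨h1, h2⟩
    refine hP _ h2 ?_
    rw [hadj, LinearMap.mem_ker.mp h1, map_zero]
  refine ⟨hdisj, le_antisymm (sup_le ?_ inf_le_right) fun y hy => ?_⟩
  · rintro _ ⟨x, hx, rfl⟩
    exact hT x hx
  let BP := B.restrict P
  let W : Submodule ℝ P := (P.map T).comap P.subtype
  have hW : IsCompl W (BP.orthogonal W) := by
    rw [LinearMap.BilinForm.isCompl_orthogonal_iff_disjoint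
      (fun x y h => by rw [← h]; exact hB _ _), Submodule.disjoint_def]
    intro x hx hx'
    exact Subtype.ext (hP x x.2 (hx' x hx))
  obtain ⟨w, hw, z, hz, hwz⟩ := Submodule.mem_sup.mp
    (hW.sup_eq_top ▸ Submodule.mem_top : (⟨y, hy⟩ : P) ∈ W ⊔ BP.orthogonal W)
  refine Submodule.mem_sup.mpr ⟨w, hw, z, ⟨LinearMap.mem_ker.mpr ?_, z.2⟩, congrArg Subtype.val hwz⟩
  refine hP _ (hT' _ z.2) ?_
  rw [← hadj]
  exact hz ⟨T (T' z), hT _ (hT' _ z.2)⟩ ⟨_, hT' _ z.2, rfl⟩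

theorem mem_homogMaps {n k : ℕ} {φ : VecPoly n} :
    φ ∈ homogMaps n k ↔ ∀ i, (φ i).IsHomogeneous (k + 1) := by
  simp [homogMaps, Submodule.mem_pi, mem_homogeneousSubmodule]

instance (n k : ℕ) : FiniteDimensional ℝ (homogMaps n k) :=
  Module.Finite.iff_fg.mpr (Submodule.fg_pi fun _ => homogeneousSubmodule_fg _ _ _)

theorem isHomogeneous_linMap {n : ℕ} (A : Matrix (Fin n) (Fin n) ℝ) (i : Fin n) :
    (linMap A i).IsHomogeneous 1 :=
  IsHomogeneous.sum _ _ _ fun j _ => Submodule.smul_mem (homogeneousSubmodule _ _ _) _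
    (isHomogeneous_X ℝ j)

theorem subsOp_mem_homogMaps {n k : ℕ} (A : Matrix (Fin n) (Fin n) ℝ) {φ : VecPoly n}
    (hφ : φ ∈ homogMaps n k) : subsOp A φ ∈ homogMaps n k := by
  rw [mem_homogMaps] at hφ ⊢
  intro i
  have := (hφ i).aeval (linMap A) (isHomogeneous_linMap A)
  rwa [one_mul] at this

theorem multOp_mem_homogMaps {n k : ℕ} (A : Matrix (Fin n) (Fin n) ℝ) {φ : VecPoly n}
    (hφ : φ ∈ homogMaps n k) : multOp A φ ∈ homogMaps n k := by
  rw [mem_homogMaps] at hφ ⊢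
  intro i
  simp only [multOp, LinearMap.pi_apply, LinearMap.sum_apply, LinearMap.smul_apply,
    LinearMap.proj_apply]
  exact IsHomogeneous.sum _ _ _ fun j _ => Submodule.smul_mem (homogeneousSubmodule _ _ _) _ (hφ j)

theorem homologicalOp_mem_homogMaps {n k : ℕ} (A : Matrix (Fin n) (Fin n) ℝ) {φ : VecPoly n}
    (hφ : φ ∈ homogMaps n k) : homologicalOp A φ ∈ homogMaps n k :=
  sub_mem (multOp_mem_homogMaps A hφ) (subsOp_mem_homogMaps A hφ)

theorem homologicalBarOp_mem_homogMaps {k : ℕ} {φ : VecPoly 5}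
    (hφ : φ ∈ homogMaps 5 k) : homologicalBarOp nilp23 φ ∈ homogMaps 5 k := by
  rw [homologicalBarOp, nilpotencyClass_nilp23]
  refine sub_mem (multOp_mem_homogMaps _ hφ) ?_
  rw [barOf_three]
  have hN {φ : VecPoly 5} := subsOp_mem_homogMaps (k := k) (φ := φ) nilp23
  have hM {φ : VecPoly 5} := subsOp_mem_homogMaps (k := k) (φ := φ) nilp23.transpose
  exact add_mem (hM hφ) (add_mem (hM (hM (hN hφ))) (hN (hM (hM hφ))))

theorem constantCoeff_eq_zero_of_mem_homogMaps {n k : ℕ} {φ : VecPoly n} (hφ : φ ∈ homogMaps n k)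
    (i : Fin n) : constantCoeff (φ i) = 0 :=
  (mem_homogMaps.mp hφ i).coeff_eq_zero (d := 0) (by simp)

theorem isStyleAt_kerStyle (k : ℕ) : IsStyleAt nilp23 k (kerStyle nilp23 k) :=
  mapForm.disjoint_and_sup_ker_of_adjoint mapForm_comm _
    (fun _ hφ => mapForm_self_eq_zero (constantCoeff_eq_zero_of_mem_homogMaps hφ))
    (fun _ => homologicalOp_mem_homogMaps nilp23) (fun _ => homologicalBarOp_mem_homogMaps)
    mapForm_homologicalOp

/-! ### Description of the kernel -/

/-- The parts of the second component of `terms23 P` in the eleven classes. -/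
def Params23.partsF (P : Params23) : (c : MonClass) → MvPolynomial (Fin c.arity) ℝ
  | c12 => P.F12
  | c15 => P.F15
  | c23 => P.F23
  | c35 => P.F35
  | c1_0 => P.F1_0
  | c1_1 => P.F1_1
  | c4_0 => P.F4_0
  | c4_1 => P.F4_1
  | c3_0 => P.F3_0
  | c3_1 => (1 / 2 : ℝ) • P.F3_1
  | c3_2 => 0

/-- The parts of the fifth component of `terms23 P` in the eleven classes. -/
def Params23.partsG (P : Params23) : (c : MonClass) → MvPolynomial (Fin c.arity) ℝ
  | c12 => P.G12
  | c15 => P.G15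
  | c23 => P.G23
  | c35 => P.G35
  | c1_0 => P.G1_0
  | c1_1 => P.G1_1
  | c4_0 => P.G4_0
  | c4_1 => P.G4_1
  | c3_0 => P.G3_0
  | c3_1 => (1 / 2 : ℝ) • P.G3_1
  | c3_2 => (1 / 2 : ℝ) • P.G3_2

theorem terms23_one (P : Params23) : terms23 P 1 = ∑ c : MonClass, c.poly (P.partsF c) := by
  simp only [sum_eq]
  simp [terms23, Params23.partsF, poly_zero, poly_c12, poly_c15, poly_c23, poly_c35, poly_c1_0,
    poly_c1_1, poly_c4_0, poly_c4_1, poly_c3_0, poly_c3_1, ev_smul]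
  ring

theorem terms23_four (P : Params23) : terms23 P 4 = ∑ c : MonClass, c.poly (P.partsG c) := by
  simp only [sum_eq]
  simp [terms23, Params23.partsG, poly_c12, poly_c15, poly_c23, poly_c35, poly_c1_0,
    poly_c1_1, poly_c4_0, poly_c4_1, poly_c3_0, poly_c3_1, poly_c3_2, ev_smul]
  ring

theorem terms23_zero (P : Params23) : terms23 P 0 = sBar (terms23 P 1) := by
  rw [terms23_one, sBar_sum_poly]
  simp only [sum_eq]
  simp [terms23, shiftBar, Params23.partsF, poly_zero, smul_smul, poly_c1_0, poly_c4_0, poly_c3_0]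

theorem two_smul_terms23_three (P : Params23) : (2 : ℝ) • terms23 P 3 = sBar (terms23 P 4) := by
  have h : (C 2 * C 2⁻¹ : MvPolynomial (Fin 5) ℝ) = 1 := by
    rw [← C_mul, mul_inv_cancel₀ two_ne_zero, C_1]
  rw [terms23_four, sBar_sum_poly]
  simp only [sum_eq]
  simp [terms23, shiftBar, Params23.partsG, poly_zero, smul_smul, poly_c1_0, poly_c4_0, poly_c3_0,
    poly_c3_1]
  simp only [smul_eq_C_mul]
  linear_combination (X 0 * ev P.G1_1 ![X 0, X 2, X 3] + X 2 * X 3 * ev P.G4_1 ![X 2, X 3]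
    + X 2 * ev P.G3_1 ![X 2] + X 3 * ev P.G3_2 ![X 3]) * h

theorem two_smul_terms23_two (P : Params23) : (2 : ℝ) • terms23 P 2 = sBar (terms23 P 3) := by
  have h : terms23 P 3 = (1 / 2 : ℝ) • sBar (terms23 P 4) := by
    rw [← two_smul_terms23_three, smul_smul]
    norm_num
  rw [h, map_smul, terms23_four, sBar_sum_poly, sBar_sum_poly]
  simp only [sum_eq]
  simp [terms23, shiftBar, Params23.partsG, poly_zero, smul_smul, poly_c3_0, ev_smul]
  simp only [smul_eq_C_mul]
  ring

theorem sBar_sBar_terms23_one (P : Params23) : sBar (sBar (terms23 P 1)) = 0 := by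
  rw [terms23_one, sBar_sum_poly, sBar_sum_poly]
  simp only [sum_eq]
  simp [shiftBar, Params23.partsF, poly_zero]

theorem sBar_sBar_sBar_terms23_four (P : Params23) : sBar (sBar (sBar (terms23 P 4))) = 0 := by
  rw [terms23_four, sBar_sum_poly, sBar_sum_poly, sBar_sum_poly]
  simp only [sum_eq]
  simp [shiftBar, poly_zero]

theorem homologicalBarOp_terms23 (P : Params23) : homologicalBarOp nilp23 (terms23 P) = 0 := by
  have h2 : sBar (terms23 P 2) = 0 := by
    have h := sBar_sBar_sBar_terms23_four P
    rw [← two_smul_terms23_three, map_smul, ← two_smul_terms23_two, map_smul, map_smul] at h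
    simpa using h
  rw [homologicalBarOp_nilp23]
  funext i
  fin_cases i
  · simp [terms23_zero, sBar_sBar_terms23_one]
  · simp [terms23_zero]
  · simp [h2]
  · simp [two_smul_terms23_two]
  · simp [two_smul_terms23_three]

theorem constantCoeff_terms23 (P : Params23) (i : Fin 5) : constantCoeff (terms23 P i) = 0 := by
  fin_cases i <;> simp [terms23]

/-- The parameters `P` for which the parts of the second and fifth components of `terms23 P` are
`F` and `G`. -/
def Params23.ofParts (F G : (c : MonClass) → MvPolynomial (Fin c.arity) ℝ) : Params23 where
  F12 := F c12
  G12 := G c12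
  F15 := F c15
  G15 := G c15
  F23 := F c23
  G23 := G c23
  F35 := F c35
  G35 := G c35
  F1_0 := F c1_0
  G1_0 := G c1_0
  F1_1 := F c1_1
  G1_1 := G c1_1
  F4_0 := F c4_0
  G4_0 := G c4_0
  F4_1 := F c4_1
  G4_1 := G c4_1
  F3_0 := F c3_0
  G3_0 := G c3_0
  F3_1 := (2 : ℝ) • F c3_1
  G3_1 := (2 : ℝ) • G c3_1
  G3_2 := (2 : ℝ) • G c3_2

theorem Params23.ofParts_parts (P : Params23) : Params23.ofParts P.partsF P.partsG = P := by
  simp [Params23.ofParts, Params23.partsF, Params23.partsG, smul_smul]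

/-- The parameters of an element of the kernel, read off from its second and fifth components. -/
def paramsOf (φ : VecPoly 5) : Params23 :=
  Params23.ofParts (fun c => c.part (φ 1)) (fun c => c.part (φ 4))

theorem paramsOf_terms23 (P : Params23) : paramsOf (terms23 P) = P := by
  simp only [paramsOf, terms23_one, terms23_four, part_sum_poly, Params23.ofParts_parts]

/-- On the kernel, the second and fifth components determine the others. -/
theorem terms23_paramsOf {φ : VecPoly 5} (h0 : ∀ i, constantCoeff (φ i) = 0)
    (hφ : homologicalBarOp nilp23 φ = 0) : terms23 (paramsOf φ) = φ := by
  rw [homologicalBarOp_nilp23] at hφ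
  have e0 : sBar (φ 0) = 0 := by simpa using congrFun hφ 0
  have e1 : φ 0 = sBar (φ 1) := sub_eq_zero.mp (by simpa using congrFun hφ 1)
  have e3 : (2 : ℝ) • φ 2 = sBar (φ 3) := sub_eq_zero.mp (by simpa using congrFun hφ 3)
  have e4 : (2 : ℝ) • φ 3 = sBar (φ 4) := sub_eq_zero.mp (by simpa using congrFun hφ 4)
  have hsum (i : Fin 5) : φ i = ∑ c : MonClass, c.poly (c.part (φ i)) := by
    conv_lhs => rw [eq_C_add_sum_poly (φ i), h0, C_0, zero_add]
  have hlast : c3_2.part (φ 1) = 0 := by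
    have h : (2 : ℝ) • c3_1.part (sBar (φ 1)) = 0 :=
      (part_sBar (sBar (φ 1)) c3_0).symm.trans (by rw [← e1, e0, map_zero])
    have h' : c3_1.part (sBar (φ 1)) = (2 : ℝ) • c3_2.part (φ 1) := part_sBar (φ 1) c3_1
    rw [h'] at h
    exact (smul_eq_zero_iff_right two_ne_zero).mp ((smul_eq_zero_iff_right two_ne_zero).mp h)
  have t1 : terms23 (paramsOf φ) 1 = φ 1 := by
    rw [terms23_one, hsum 1]
    refine Finset.sum_congr rfl fun c _ => congrArg _ ?_
    cases c <;> first
      | rfl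
      | exact hlast.symm
      | simp [Params23.partsF, paramsOf, Params23.ofParts, smul_smul]
  have t4 : terms23 (paramsOf φ) 4 = φ 4 := by
    rw [terms23_four, hsum 4]
    refine Finset.sum_congr rfl fun c _ => congrArg _ ?_
    cases c <;> first | rfl | simp [Params23.partsG, paramsOf, Params23.ofParts, smul_smul]
  have t3 : terms23 (paramsOf φ) 3 = φ 3 :=
    smul_right_injective _ (two_ne_zero (α := ℝ)) (by
      change (2 : ℝ) • _ = (2 : ℝ) • _
      rw [two_smul_terms23_three, t4, e4])
  funext i
  fin_cases i
  · exact (terms23_zero _).trans (by rw [t1, ← e1]; rfl)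
  · exact t1
  · refine smul_right_injective _ (two_ne_zero (α := ℝ)) ?_
    change (2 : ℝ) • terms23 (paramsOf φ) 2 = (2 : ℝ) • φ 2
    rw [two_smul_terms23_two, t3, e3]
  · exact t3
  · exact t4

/-- The kernel, restricted to maps vanishing at `0`, is parametrized bijectively by `terms23`. -/
theorem homologicalBarOp_eq_zero_iff {φ : VecPoly 5} :
    ((∀ i, constantCoeff (φ i) = 0) ∧ homologicalBarOp nilp23 φ = 0) ↔
      ∃! P : Params23, φ = terms23 P := by
  constructor
  · rintro ⟨h0, h⟩
    exact ⟨paramsOf φ, (terms23_paramsOf h0 h).symm, fun P hP => by rw [hP, paramsOf_terms23]⟩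
  · rintro ⟨P, rfl, -⟩
    exact ⟨constantCoeff_terms23 P, homologicalBarOp_terms23 P⟩

theorem constantCoeff_linMap {n : ℕ} (A : Matrix (Fin n) (Fin n) ℝ) (i : Fin n) :
    constantCoeff (linMap A i) = 0 :=
  (isHomogeneous_linMap A i).coeff_eq_zero (d := 0) (by simp)

/-! ### Formal maps and their order of vanishing -/

section HighOrder

variable {σ : Type*}

/-- The ideal of the power series all of whose terms have degree at least `d`. -/
def highOrder (σ : Type*) (d : ℕ) : Ideal (MvPowerSeries σ ℝ) where
  carrier := {f | (d : ℕ∞) ≤ f.order}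
  add_mem' hf hg := (le_min hf hg).trans MvPowerSeries.min_order_le_add
  zero_mem' := by simp
  smul_mem' f g hg := (le_trans (show (d : ℕ∞) ≤ f.order + g.order from
    le_add_left hg) MvPowerSeries.le_order_mul)

theorem mem_highOrder_iff_order {d : ℕ} {f : MvPowerSeries σ ℝ} :
    f ∈ highOrder σ d ↔ (d : ℕ∞) ≤ f.order := Iff.rfl

theorem mem_highOrder {d : ℕ} {f : MvPowerSeries σ ℝ} :
    f ∈ highOrder σ d ↔ ∀ e : σ →₀ ℕ, e.degree < d → MvPowerSeries.coeff e f = 0 :=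
  ⟨fun h _ he => MvPowerSeries.coeff_of_lt_order ((Nat.cast_lt.mpr he).trans_le h),
    fun h => MvPowerSeries.nat_le_order h⟩

theorem highOrder_anti {d d' : ℕ} (h : d ≤ d') : highOrder σ d' ≤ highOrder σ d :=
  fun _ hf => (Nat.cast_le.mpr h : (d : ℕ∞) ≤ d').trans hf

theorem mem_highOrder_one {f : MvPowerSeries σ ℝ} :
    f ∈ highOrder σ 1 ↔ MvPowerSeries.constantCoeff f = 0 := by
  rw [mem_highOrder_iff_order, Nat.cast_one, MvPowerSeries.one_le_order_iff_constCoeff_eq_zero]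

theorem mul_mem_highOrder {a b : ℕ} {f g : MvPowerSeries σ ℝ} (hf : f ∈ highOrder σ a)
    (hg : g ∈ highOrder σ b) : f * g ∈ highOrder σ (a + b) := by
  rw [mem_highOrder_iff_order, Nat.cast_add]
  exact (add_le_add hf hg).trans MvPowerSeries.le_order_mul

theorem eq_zero_of_forall_mem_highOrder {f : MvPowerSeries σ ℝ}
    (h : ∀ d, f ∈ highOrder σ (d + 2)) : f = 0 := by
  ext e
  exact mem_highOrder.mp (h e.degree) e (by lia)

theorem coe_mem_highOrder {p : MvPolynomial σ ℝ} {d : ℕ} (hp : p.IsHomogeneous d) :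
    (p : MvPowerSeries σ ℝ) ∈ highOrder σ d := by
  rw [mem_highOrder]
  intro e he
  rw [MvPolynomial.coeff_coe]
  exact hp.coeff_eq_zero he.ne

/-- Successive approximation: a sequence of families of power series, each of which differs from
the preceding one by terms of higher and higher degree, has a limit. -/
theorem exists_limit {ι : Type*} (P : ℕ → (ι → MvPowerSeries σ ℝ) → Prop)
    {u₀ : ι → MvPowerSeries σ ℝ} (h₀ : P 0 u₀)
    (hstep : ∀ s u, P s u → ∃ u', P (s + 1) u' ∧ ∀ i, u' i - u i ∈ highOrder σ (s + 2)) :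
    ∃ u : ι → MvPowerSeries σ ℝ, ∀ s, ∃ v, P s v ∧ ∀ i, u i - v i ∈ highOrder σ (s + 2) := by
  choose next hnext hdiff using hstep
  let seq : (s : ℕ) → {u // P s u} :=
    Nat.rec ⟨u₀, h₀⟩ fun s u => ⟨next s u.1 u.2, hnext s u.1 u.2⟩
  have hone (s : ℕ) (i : ι) : (seq (s + 1)).1 i - (seq s).1 i ∈ highOrder σ (s + 2) :=
    hdiff s _ _ i
  have hcauchy (s t : ℕ) (i : ι) : (seq (s + t)).1 i - (seq s).1 i ∈ highOrder σ (s + 2) := by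
    induction t with
    | zero => simp
    | succ t ih =>
      have := add_mem (highOrder_anti (by lia : s + 2 ≤ s + t + 2) (hone (s + t) i)) ih
      rwa [sub_add_sub_cancel] at this
  let u (i : ι) : MvPowerSeries σ ℝ := fun e => MvPowerSeries.coeff e ((seq e.degree).1 i)
  have hu (i : ι) (e : σ →₀ ℕ) :
      MvPowerSeries.coeff e (u i) = MvPowerSeries.coeff e ((seq e.degree).1 i) := rfl
  refine ⟨u, fun s => ⟨_, (seq s).2, fun i => ?_⟩⟩
  rw [mem_highOrder]
  intro e he
  rw [map_sub, sub_eq_zero, hu]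
  rcases Nat.lt_succ_iff_lt_or_eq.mp he with h | h
  · obtain ⟨t, rfl⟩ := Nat.exists_eq_add_of_le (Nat.lt_succ_iff.mp h)
    have := mem_highOrder.mp (hcauchy e.degree t i) e (by lia)
    rw [map_sub, sub_eq_zero] at this
    exact this.symm
  · have := mem_highOrder.mp (hone s i) e he
    rw [map_sub, sub_eq_zero] at this
    rw [h]
    exact this

variable {τ : Type*}

theorem prod_pow_sub_mem_highOrder {φ φ' : σ → MvPowerSeries τ ℝ} {D : ℕ}
    (hφ : ∀ i, φ i ∈ highOrder τ 1) (hφ' : ∀ i, φ' i ∈ highOrder τ 1)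
    (h : ∀ i, φ' i - φ i ∈ highOrder τ (D + 1)) (d : σ →₀ ℕ) :
    (d.prod fun i m => φ' i ^ m) - (d.prod fun i m => φ i ^ m) ∈ highOrder τ (D + d.degree) := by
  -- The property that is multiplicative in `(k, a, a')` and holds for the factors.
  let Q (k : ℕ) (a a' : MvPowerSeries τ ℝ) : Prop :=
    a ∈ highOrder τ k ∧ a' ∈ highOrder τ k ∧ a' - a ∈ highOrder τ (D + k)
  have hone : Q 0 1 1 := ⟨by simp [mem_highOrder], by simp [mem_highOrder], by simp⟩
  have hmul {k l : ℕ} {a a' b b' : MvPowerSeries τ ℝ} (ha : Q k a a') (hb : Q l b b') :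
      Q (k + l) (a * b) (a' * b') := by
    refine ⟨mul_mem_highOrder ha.1 hb.1, mul_mem_highOrder ha.2.1 hb.2.1, ?_⟩
    have e : a' * b' - a * b = a' * (b' - b) + (a' - a) * b := by ring
    rw [e]
    refine add_mem ?_ ?_
    · have := mul_mem_highOrder ha.2.1 hb.2.2
      rwa [show k + (D + l) = D + (k + l) by ring] at this
    · have := mul_mem_highOrder ha.2.2 hb.1
      rwa [add_assoc] at this
  suffices Q d.degree (d.prod fun i m => φ i ^ m) (d.prod fun i m => φ' i ^ m) from this.2.2
  induction d using Finsupp.induction_linear with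
  | zero => simpa using hone
  | add f g hf hg =>
    rw [Finsupp.prod_add_index' (by simp) (by simp [pow_add]),
      Finsupp.prod_add_index' (by simp) (by simp [pow_add]), map_add]
    exact hmul hf hg
  | single i m =>
    rw [Finsupp.prod_single_index (by simp), Finsupp.prod_single_index (by simp),
      Finsupp.degree_single]
    induction m with
    | zero => simpa using hone
    | succ m ih =>
      rw [pow_succ, pow_succ]
      exact hmul ih ⟨hφ i, hφ' i, h i⟩

variable [Finite σ]

theorem hasSubst_of_mem_highOrder {φ : σ → MvPowerSeries τ ℝ} (hφ : ∀ i, φ i ∈ highOrder τ 1) :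
    MvPowerSeries.HasSubst φ :=
  MvPowerSeries.hasSubst_of_constantCoeff_zero fun i => mem_highOrder_one.mp (hφ i)

theorem subst_mem_highOrder {φ : σ → MvPowerSeries τ ℝ} (hφ : ∀ i, φ i ∈ highOrder τ 1)
    {r : ℕ} {h : MvPowerSeries σ ℝ} (hh : h ∈ highOrder σ r) :
    MvPowerSeries.subst φ h ∈ highOrder τ r := by
  rw [mem_highOrder_iff_order] at hh ⊢
  refine le_trans ?_ (MvPowerSeries.le_order_subst (hasSubst_of_mem_highOrder hφ) h)
  calc (r : ℕ∞) = 1 * r := (one_mul _).symm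
    _ ≤ _ := mul_le_mul' (le_iInf fun i => by exact_mod_cast hφ i) hh

/-- Changing the inner map of a composition by terms of degree at least `D + 1` changes the
composition by terms of degree at least `D + r`, if the outer series vanishes to order `r`. -/
theorem subst_sub_subst_mem_highOrder {φ φ' : σ → MvPowerSeries τ ℝ} {D r : ℕ}
    (hφ : ∀ i, φ i ∈ highOrder τ 1) (hφ' : ∀ i, φ' i ∈ highOrder τ 1)
    (hd : ∀ i, φ' i - φ i ∈ highOrder τ (D + 1)) {h : MvPowerSeries σ ℝ}
    (hh : h ∈ highOrder σ r) :
    MvPowerSeries.subst φ' h - MvPowerSeries.subst φ h ∈ highOrder τ (D + r) := by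
  rw [mem_highOrder]
  intro e he
  have s := hasSubst_of_mem_highOrder hφ
  have s' := hasSubst_of_mem_highOrder hφ'
  rw [map_sub, MvPowerSeries.coeff_subst s, MvPowerSeries.coeff_subst s',
    ← finsum_sub_distrib (MvPowerSeries.coeff_subst_finite s' h e)
      (MvPowerSeries.coeff_subst_finite s h e)]
  refine finsum_eq_zero_of_forall_eq_zero fun d => ?_
  rw [← smul_sub, ← map_sub]
  rcases lt_or_ge d.degree r with hdr | hdr
  · rw [mem_highOrder.mp hh d hdr, zero_smul]
  · rw [mem_highOrder.mp (prod_pow_sub_mem_highOrder hφ hφ' hd d) e (by lia), smul_zero]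

end HighOrder

section HomogPart

variable {n : ℕ}

theorem coeff_homogPart (d : ℕ) (f : FormalMap n) (i : Fin n) (e : Fin n →₀ ℕ) :
    coeff e (homogPart d f i) = if e.degree = d then MvPowerSeries.coeff e (f i) else 0 := by
  rw [homogPart, coeff_homogeneousComponent]
  split_ifs with h
  · rw [MvPowerSeries.coeff_truncTotal _ (by lia)]
  · rfl

theorem homogPart_mem_homogMaps (k : ℕ) (f : FormalMap n) :
    homogPart (k + 1) f ∈ homogMaps n k :=
  mem_homogMaps.mpr fun _ => homogeneousComponent_isHomogeneous _ _

theorem homogPart_congr {d : ℕ} {f g : FormalMap n} (h : ∀ i, f i - g i ∈ highOrder _ (d + 1)) :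
    homogPart d f = homogPart d g := by
  funext i
  ext e
  rw [coeff_homogPart, coeff_homogPart]
  split_ifs with he
  · have := mem_highOrder.mp (h i) e (by lia)
    rwa [map_sub, sub_eq_zero] at this
  · rfl

theorem homogPart_add (d : ℕ) (f g : FormalMap n) :
    homogPart d (f + g) = homogPart d f + homogPart d g := by
  funext i
  ext e
  simp only [Pi.add_apply, coeff_add, coeff_homogPart, map_add]
  split_ifs <;> simp

/-- The formal map given by a polynomial map. -/
def toFormal (φ : VecPoly n) : FormalMap n := fun i => (φ i : MvPowerSeries (Fin n) ℝ)

theorem toFormal_apply (φ : VecPoly n) (i : Fin n) :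
    toFormal φ i = (φ i : MvPowerSeries (Fin n) ℝ) := rfl

theorem homogPart_toFormal {d : ℕ} {φ : VecPoly n} (hφ : ∀ i, (φ i).IsHomogeneous d) :
    homogPart d (toFormal φ) = φ := by
  funext i
  ext e
  rw [coeff_homogPart, toFormal_apply, MvPolynomial.coeff_coe]
  split_ifs with h
  · rfl
  · exact ((hφ i).coeff_eq_zero h).symm

theorem homogPart_toFormal_of_ne {d d' : ℕ} (hd : d' ≠ d) {φ : VecPoly n}
    (hφ : ∀ i, (φ i).IsHomogeneous d) : homogPart d' (toFormal φ) = 0 := by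
  funext i
  ext e
  rw [coeff_homogPart, toFormal_apply, MvPolynomial.coeff_coe]
  split_ifs with h
  · exact (hφ i).coeff_eq_zero (by lia)
  · rfl

theorem sub_homogPart_mem_highOrder {d : ℕ} {f : FormalMap n} (hf : ∀ i, f i ∈ highOrder _ d)
    (i : Fin n) : f i - toFormal (homogPart d f) i ∈ highOrder _ (d + 1) := by
  rw [mem_highOrder]
  intro e he
  rw [map_sub, toFormal_apply, MvPolynomial.coeff_coe, coeff_homogPart]
  split_ifs with h
  · exact sub_self _
  · rw [mem_highOrder.mp (hf i) e (by lia), sub_zero]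

theorem toFormal_mem_highOrder {k : ℕ} {φ : VecPoly n} (hφ : φ ∈ homogMaps n k) (i : Fin n) :
    toFormal φ i ∈ highOrder _ (k + 1) :=
  coe_mem_highOrder (mem_homogMaps.mp hφ i)

theorem toFormal_linMap_mem_highOrder (A : Matrix (Fin n) (Fin n) ℝ) (i : Fin n) :
    toFormal (linMap A) i ∈ highOrder _ 1 :=
  coe_mem_highOrder (isHomogeneous_linMap A i)

theorem toFormal_linMap_one : toFormal (linMap (1 : Matrix (Fin n) (Fin n) ℝ)) =
    MvPowerSeries.X := by
  funext i
  simp [toFormal, linMap, Matrix.one_apply]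

theorem hasLinearPart_iff {A : Matrix (Fin n) (Fin n) ℝ} {f : FormalMap n} :
    HasLinearPart A f ↔ ∀ i, f i - toFormal (linMap A) i ∈ highOrder _ 2 := by
  constructor
  · rintro ⟨h0, h1⟩ i
    rw [← h1]
    exact sub_homogPart_mem_highOrder (fun i => mem_highOrder_one.mpr (h0 i)) i
  · intro h
    refine ⟨fun i => mem_highOrder_one.mp ?_, ?_⟩
    · have := add_mem (highOrder_anti one_le_two (h i)) (toFormal_linMap_mem_highOrder A i)
      rwa [sub_add_cancel] at this
    · rw [homogPart_congr h, homogPart_toFormal (isHomogeneous_linMap A)]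

theorem HasLinearPart.mem_highOrder_one {A : Matrix (Fin n) (Fin n) ℝ} {f : FormalMap n}
    (h : HasLinearPart A f) (i : Fin n) : f i ∈ highOrder _ 1 :=
  MapNF.mem_highOrder_one.mpr (h.1 i)

theorem HasLinearPart.hasSubst {A : Matrix (Fin n) (Fin n) ℝ} {f : FormalMap n}
    (h : HasLinearPart A f) : MvPowerSeries.HasSubst f :=
  hasSubst_of_mem_highOrder h.mem_highOrder_one

theorem hasLinearPart_X : HasLinearPart (1 : Matrix (Fin n) (Fin n) ℝ) MvPowerSeries.X :=
  hasLinearPart_iff.mpr fun i => by rw [toFormal_linMap_one, sub_self]; exact zero_mem _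

theorem HasLinearPart.of_sub_mem {A : Matrix (Fin n) (Fin n) ℝ} {f g : FormalMap n}
    (h : HasLinearPart A g) (hfg : ∀ i, f i - g i ∈ highOrder _ 2) : HasLinearPart A f := by
  rw [hasLinearPart_iff] at h ⊢
  intro i
  have := add_mem (hfg i) (h i)
  rwa [sub_add_sub_cancel] at this

end HomogPart

/-! ### Composition of formal maps -/

section Comp

variable {n : ℕ}

theorem comp_X (f : FormalMap n) : comp f MvPowerSeries.X = f := by
  funext i
  rw [comp, MvPowerSeries.subst_self]
  rfl

theorem X_comp {f : FormalMap n} (hf : MvPowerSeries.HasSubst f) :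
    comp MvPowerSeries.X f = f :=
  funext fun i => MvPowerSeries.subst_X hf i

theorem comp_assoc (f : FormalMap n) {g h : FormalMap n} (hg : MvPowerSeries.HasSubst g)
    (hh : MvPowerSeries.HasSubst h) : comp (comp f g) h = comp f (comp g h) :=
  funext fun i => MvPowerSeries.subst_comp_subst_apply hg hh (f i)

theorem comp_add (f f' : FormalMap n) {g : FormalMap n} (hg : MvPowerSeries.HasSubst g) :
    comp (f + f') g = comp f g + comp f' g :=
  funext fun i => MvPowerSeries.subst_add hg (f i) (f' i)

theorem comp_sub (f f' : FormalMap n) {g : FormalMap n} (hg : MvPowerSeries.HasSubst g) :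
    comp (f - f') g = comp f g - comp f' g :=
  funext fun i => MvPowerSeries.subst_sub hg (f i) (f' i)

theorem toFormal_comp_linMap (φ : VecPoly n) (A : Matrix (Fin n) (Fin n) ℝ) :
    comp (toFormal φ) (toFormal (linMap A)) = toFormal (subsOp A φ) := by
  funext i
  rw [comp, toFormal_apply, MvPowerSeries.subst_coe, toFormal_apply]
  change _ = coeToMvPowerSeries.algHom ℝ (aeval (linMap A) (φ i))
  rw [← AlgHom.comp_apply, comp_aeval]
  rfl

theorem linMap_comp (A : Matrix (Fin n) (Fin n) ℝ) (f : FormalMap n) (i : Fin n) :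
    comp (toFormal (linMap A)) f i = ∑ j, A i j • f j := by
  rw [comp, toFormal_apply, MvPowerSeries.subst_coe, linMap]
  simp

theorem toFormal_multOp (A : Matrix (Fin n) (Fin n) ℝ) (φ : VecPoly n) (i : Fin n) :
    toFormal (multOp A φ) i = ∑ j, A i j • toFormal φ j := by
  change coeToMvPowerSeries.algHom ℝ (multOp A φ i) = _
  simp only [multOp, LinearMap.pi_apply, LinearMap.sum_apply, LinearMap.smul_apply,
    LinearMap.proj_apply, map_sum, map_smul]
  rfl

theorem comp_sub_comp_mem_highOrder {f g g' : FormalMap n} {D r : ℕ}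
    (hg : ∀ i, g i ∈ highOrder _ 1) (hg' : ∀ i, g' i ∈ highOrder _ 1)
    (hd : ∀ i, g' i - g i ∈ highOrder _ (D + 1)) (hf : ∀ i, f i ∈ highOrder _ r) (i : Fin n) :
    comp f g' i - comp f g i ∈ highOrder _ (D + r) :=
  subst_sub_subst_mem_highOrder hg hg' hd (hf i)

/-- Congruent formal maps have congruent compositions. -/
theorem comp_congr_highOrder {f f' g g' : FormalMap n} {d : ℕ}
    (hg : ∀ i, g i ∈ highOrder _ 1) (hg' : ∀ i, g' i ∈ highOrder _ 1)
    (hd : ∀ i, g' i - g i ∈ highOrder _ d) (hf : ∀ i, f i ∈ highOrder _ 1)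
    (hff : ∀ i, f' i - f i ∈ highOrder _ d) (i : Fin n) :
    comp f' g' i - comp f g i ∈ highOrder _ d := by
  have h1 : comp f' g' i - comp f g' i ∈ highOrder _ d := by
    rw [← Pi.sub_apply, ← comp_sub _ _ (hasSubst_of_mem_highOrder hg')]
    exact subst_mem_highOrder hg' (hff i)
  rcases d with _ | d
  · simp [mem_highOrder]
  · have := add_mem h1 (comp_sub_comp_mem_highOrder hg hg' hd hf i)
    rwa [sub_add_sub_cancel] at this

end Comp

/-! ### Inversion and conjugation of formal maps -/

section Conj

variable {n : ℕ}

/-- A formal map tangent to the identity has a right inverse tangent to the identity. -/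
theorem exists_right_inverse {φ : FormalMap n} (hφ : HasLinearPart 1 φ) :
    ∃ ψ : FormalMap n, HasLinearPart 1 ψ ∧ comp φ ψ = MvPowerSeries.X := by
  let P (s : ℕ) (ψ : FormalMap n) : Prop :=
    HasLinearPart 1 ψ ∧ ∀ i, comp φ ψ i - MvPowerSeries.X i ∈ highOrder _ (s + 2)
  have h₀ : P 0 MvPowerSeries.X := ⟨hasLinearPart_X, fun i => by
    rw [comp_X, ← toFormal_linMap_one]
    exact hasLinearPart_iff.mp hφ i⟩
  have hstep (s : ℕ) (ψ : FormalMap n) (h : P s ψ) :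
      ∃ ψ', P (s + 1) ψ' ∧ ∀ i, ψ' i - ψ i ∈ highOrder _ (s + 2) := by
    obtain ⟨hψ1, hψ⟩ := h
    -- Subtracting the error corrects it to the next order since `φ` is tangent to the identity.
    let ψ' : FormalMap n := ψ - (comp φ ψ - MvPowerSeries.X)
    have hdiff (i : Fin n) : ψ' i - ψ i ∈ highOrder _ (s + 2) := by
      have e : ψ' i - ψ i = -(comp φ ψ i - MvPowerSeries.X i) := by
        simp [ψ']
      rw [e]
      exact neg_mem (hψ i)
    have hψ'1 : HasLinearPart 1 ψ' :=
      hψ1.of_sub_mem fun i => highOrder_anti (by lia) (hdiff i)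
    refine ⟨ψ', ⟨hψ'1, fun i => ?_⟩, hdiff⟩
    have key := comp_sub_comp_mem_highOrder (f := φ - MvPowerSeries.X) (D := s + 1) (r := 2)
      hψ1.mem_highOrder_one hψ'1.mem_highOrder_one hdiff
      (fun i => by
        rw [Pi.sub_apply, ← toFormal_linMap_one]
        exact hasLinearPart_iff.mp hφ i) i
    rw [comp_sub _ _ hψ1.hasSubst, comp_sub _ _ hψ'1.hasSubst, X_comp hψ1.hasSubst,
      X_comp hψ'1.hasSubst] at key
    have e : comp φ ψ' i - MvPowerSeries.X i =
        (comp φ ψ' - ψ') i - (comp φ ψ - ψ) i := by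
      simp [ψ']
      ring
    rw [e]
    exact key
  obtain ⟨ψ, hψ⟩ := exists_limit P h₀ hstep
  have hψ1 : HasLinearPart 1 ψ := by
    obtain ⟨v, hv, h⟩ := hψ 0
    exact hv.1.of_sub_mem h
  refine ⟨ψ, hψ1, ?_⟩
  funext i
  rw [← sub_eq_zero]
  refine eq_zero_of_forall_mem_highOrder fun s => ?_
  obtain ⟨v, hv, h⟩ := hψ s
  have := add_mem (comp_congr_highOrder hv.1.mem_highOrder_one hψ1.mem_highOrder_one h
    hφ.mem_highOrder_one (fun i => by rw [sub_self]; exact zero_mem _) i) (hv.2 i)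
  rwa [sub_add_sub_cancel] at this

/-- A formal map tangent to the identity has an inverse tangent to the identity. -/
theorem exists_inverse {φ : FormalMap n} (hφ : HasLinearPart 1 φ) :
    ∃ ψ : FormalMap n, HasLinearPart 1 ψ ∧ comp φ ψ = MvPowerSeries.X ∧
      comp ψ φ = MvPowerSeries.X := by
  obtain ⟨ψ, hψ, h⟩ := exists_right_inverse hφ
  obtain ⟨χ, hχ, h'⟩ := exists_right_inverse hψ
  have : φ = χ := by
    rw [← comp_X φ, ← h', ← comp_assoc _ hψ.hasSubst hχ.hasSubst, h, X_comp hχ.hasSubst]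
  exact ⟨ψ, hψ, h, this ▸ h'⟩

/-- Correction of an approximate conjugation `φ ∘ f ≈ g ∘ φ` by homogeneous terms `δ` and `c` of
the next degree: they subtract `homologicalOp A δ + c` from the error, up to terms of higher
degree. -/
theorem conj_step {A : Matrix (Fin n) (Fin n) ℝ} {f φ g : FormalMap n} {s : ℕ}
    (hf : HasLinearPart A f) (hφ : HasLinearPart 1 φ) (hg : HasLinearPart A g)
    {δ c : VecPoly n} (hδ : δ ∈ homogMaps n (s + 1)) (hc : c ∈ homogMaps n (s + 1))
    (i : Fin n) :
    (comp (φ + toFormal δ) f i - comp (g + toFormal c) (φ + toFormal δ) i)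
      - (comp φ f i - comp g φ i - toFormal (homologicalOp A δ + c) i) ∈ highOrder _ (s + 3) := by
  have hδφ (i : Fin n) : (φ + toFormal δ) i - φ i ∈ highOrder _ (s + 2) := by
    rw [Pi.add_apply, add_sub_cancel_left]
    exact toFormal_mem_highOrder hδ i
  have hφ' : HasLinearPart 1 (φ + toFormal δ) :=
    hφ.of_sub_mem fun i => highOrder_anti (by lia) (hδφ i)
  -- `δ ∘ f` agrees with `δ ∘ A`.
  have k1 := comp_sub_comp_mem_highOrder (f := toFormal δ) (D := 1) (r := s + 2)
    (toFormal_linMap_mem_highOrder A) hf.mem_highOrder_one (hasLinearPart_iff.mp hf)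
    (toFormal_mem_highOrder hδ) i
  rw [toFormal_comp_linMap] at k1
  -- The nonlinear part of `g` does not see `δ`.
  have k2 := comp_sub_comp_mem_highOrder (f := g - toFormal (linMap A)) (D := s + 1) (r := 2)
    hφ.mem_highOrder_one hφ'.mem_highOrder_one hδφ (hasLinearPart_iff.mp hg) i
  rw [comp_sub _ _ hφ.hasSubst, comp_sub _ _ hφ'.hasSubst, Pi.sub_apply, Pi.sub_apply,
    linMap_comp, linMap_comp] at k2
  -- `c ∘ (φ + δ)` agrees with `c`.
  have k3 := comp_sub_comp_mem_highOrder (f := toFormal c) (D := 1) (r := s + 2)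
    hasLinearPart_X.mem_highOrder_one hφ'.mem_highOrder_one
    (by rw [← toFormal_linMap_one]; exact hasLinearPart_iff.mp hφ')
    (toFormal_mem_highOrder hc) i
  rw [comp_X] at k3
  have e : toFormal (homologicalOp A δ + c) i =
      ∑ j, A i j • toFormal δ j - toFormal (subsOp A δ) i + toFormal c i := by
    rw [← toFormal_multOp]
    change coeToMvPowerSeries.algHom ℝ (multOp A δ i - subsOp A δ i + c i) = _
    rw [map_add, map_sub]
    rfl
  rw [comp_add _ _ hf.hasSubst, comp_add _ _ hφ'.hasSubst, Pi.add_apply, Pi.add_apply, e]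
  simp only [Pi.add_apply, smul_add, Finset.sum_add_distrib] at k2
  rw [show 1 + (s + 2) = s + 3 by ring] at k1 k3
  have := sub_mem (sub_mem k1 k2) k3
  convert this using 1
  ring

/-- Given complements `C k` to the images of the homological operator, every formal map with linear
part `A` is conjugate to one in normal form by a formal map tangent to the identity. -/
theorem exists_conj_isNormalForm {A : Matrix (Fin n) (Fin n) ℝ}
    {C : ℕ → Submodule ℝ (VecPoly n)} (hC : ∀ k, 1 ≤ k → IsStyleAt A k (C k))
    {f : FormalMap n} (hf : HasLinearPart A f) :
    ∃ φ g : FormalMap n, HasLinearPart 1 φ ∧ IsNormalForm A C g ∧ comp φ f = comp g φ := by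
  -- The pair `(φ, g)` is the limit of approximate solutions.
  let P (s : ℕ) (u : Fin n ⊕ Fin n → MvPowerSeries (Fin n) ℝ) : Prop :=
    HasLinearPart 1 (u ∘ Sum.inl) ∧ HasLinearPart A (u ∘ Sum.inr) ∧
      (∀ k, 1 ≤ k → homogPart (k + 1) (u ∘ Sum.inr) ∈ C k) ∧
      ∀ i, comp (u ∘ Sum.inl) f i - comp (u ∘ Sum.inr) (u ∘ Sum.inl) i ∈ highOrder _ (s + 2)
  have h₀ : P 0 (Sum.elim MvPowerSeries.X (toFormal (linMap A))) := by
    refine ⟨hasLinearPart_X, ?_, fun k hk => ?_, fun i => ?_⟩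
    · rw [Sum.elim_comp_inr, hasLinearPart_iff]
      intro i
      rw [sub_self]
      exact zero_mem _
    · rw [Sum.elim_comp_inr, homogPart_toFormal_of_ne (by lia) (isHomogeneous_linMap A)]
      exact zero_mem _
    · rw [Sum.elim_comp_inl, Sum.elim_comp_inr, comp_X, X_comp hf.hasSubst]
      exact hasLinearPart_iff.mp hf i
  have hstep (s : ℕ) (u : Fin n ⊕ Fin n → MvPowerSeries (Fin n) ℝ) (h : P s u) :
      ∃ u', P (s + 1) u' ∧ ∀ i, u' i - u i ∈ highOrder _ (s + 2) := by
    obtain ⟨hφ, hg, hgC, hE⟩ := h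
    set φ : FormalMap n := u ∘ Sum.inl with hφ_def
    set g : FormalMap n := u ∘ Sum.inr with hg_def
    let R : VecPoly n := homogPart (s + 2) (comp φ f - comp g φ)
    obtain ⟨-, hsup⟩ := hC (s + 1) (by lia)
    have hR : R ∈ (homogMaps n (s + 1)).map (homologicalOp A) ⊔ C (s + 1) := by
      rw [hsup]
      exact homogPart_mem_homogMaps _ _
    obtain ⟨_, ⟨δ, hδ, rfl⟩, c, hcC, hRc⟩ := Submodule.mem_sup.mp hR
    have hc : c ∈ homogMaps n (s + 1) := hsup ▸ Submodule.mem_sup_right hcC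
    have hδ2 := toFormal_mem_highOrder hδ
    have hc2 := toFormal_mem_highOrder hc
    refine ⟨Sum.elim (φ + toFormal δ) (g + toFormal c), ⟨?_, ?_, fun k hk => ?_, fun i => ?_⟩, ?_⟩
    · refine hφ.of_sub_mem fun i => ?_
      rw [Sum.elim_comp_inl, Pi.add_apply, add_sub_cancel_left]
      exact highOrder_anti (by lia) (hδ2 i)
    · refine hg.of_sub_mem fun i => ?_
      rw [Sum.elim_comp_inr, Pi.add_apply, add_sub_cancel_left]
      exact highOrder_anti (by lia) (hc2 i)
    · rw [Sum.elim_comp_inr, homogPart_add]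
      refine add_mem (hgC k hk) ?_
      by_cases hks : k = s + 1
      · subst hks
        rwa [homogPart_toFormal (mem_homogMaps.mp hc)]
      · rw [homogPart_toFormal_of_ne (by lia) (mem_homogMaps.mp hc)]
        exact zero_mem _
    · rw [Sum.elim_comp_inl, Sum.elim_comp_inr]
      have := add_mem (conj_step hf hφ hg hδ hc i)
        (sub_homogPart_mem_highOrder (f := comp φ f - comp g φ) hE i)
      have hRc' : homologicalOp A δ + c = homogPart (s + 2) (comp φ f - comp g φ) := hRc
      rw [hRc', Pi.sub_apply, sub_add_cancel] at this
      exact this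
    · rintro (i | i)
      · simpa [hφ_def] using hδ2 i
      · simpa [hg_def] using hc2 i
  obtain ⟨u, hu⟩ := exists_limit P h₀ hstep
  have hφ : HasLinearPart 1 (u ∘ Sum.inl) := by
    obtain ⟨v, hv, h⟩ := hu 0
    exact hv.1.of_sub_mem fun i => h (Sum.inl i)
  have hg : HasLinearPart A (u ∘ Sum.inr) := by
    obtain ⟨v, hv, h⟩ := hu 0
    exact hv.2.1.of_sub_mem fun i => h (Sum.inr i)
  refine ⟨u ∘ Sum.inl, u ∘ Sum.inr, hφ, ⟨hg, fun k hk => ⟨hC k hk, ?_⟩⟩, ?_⟩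
  · obtain ⟨v, hv, h⟩ := hu k
    rw [homogPart_congr (f := u ∘ Sum.inr) (g := v ∘ Sum.inr) fun i => h (Sum.inr i)]
    exact hv.2.2.1 k hk
  · funext i
    rw [← sub_eq_zero]
    refine eq_zero_of_forall_mem_highOrder fun s => ?_
    obtain ⟨v, ⟨hv1, hv2, -, hv⟩, h⟩ := hu s
    have h1 := comp_congr_highOrder (f := v ∘ Sum.inl) (f' := u ∘ Sum.inl) (g := f) (g' := f)
      (d := s + 2) hf.mem_highOrder_one hf.mem_highOrder_one
      (fun i => by rw [sub_self]; exact zero_mem _) hv1.mem_highOrder_one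
      (fun i => h (Sum.inl i)) i
    have h2 := comp_congr_highOrder (f := v ∘ Sum.inr) (f' := u ∘ Sum.inr)
      hv1.mem_highOrder_one hφ.mem_highOrder_one (fun i => h (Sum.inl i))
      hv2.mem_highOrder_one (fun i => h (Sum.inr i)) i
    have := add_mem (sub_mem h1 h2) (hv i)
    convert this using 1
    ring

end Conj

end

end MapNF

theorem mainTheorem5 :
    -- the kernel is a complement to the image of the homological operator in every degree
    (∀ k : ℕ, MapNF.IsStyleAt MapNF.nilp23 k (MapNF.kerStyle MapNF.nilp23 k)) ∧
    -- polynomial maps `F` with `F(0) = 0` and `F - N x` in the kernel: existence and uniqueness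
    -- of the displayed representation
    (∀ F : MapNF.VecPoly 5,
      ((∀ i, MvPolynomial.constantCoeff (F i) = 0) ∧
          MapNF.homologicalBarOp MapNF.nilp23 (F - MapNF.linMap MapNF.nilp23) = 0) ↔
        ∃! P : MapNF.Params23, F = MapNF.linMap MapNF.nilp23 + MapNF.terms23 P) ∧
    -- formal maps in normal form, degree by degree
    (∀ g : MapNF.FormalMap 5,
      MapNF.IsNormalForm MapNF.nilp23 (MapNF.kerStyle MapNF.nilp23) g ↔
        MapNF.HasLinearPart MapNF.nilp23 g ∧
          ∀ k : ℕ, 1 ≤ k → ∃! P : MapNF.Params23,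
            MapNF.homogPart (k + 1) g = MapNF.terms23 P) ∧
    -- every formal map with linear part `N x` is conjugate to one in normal form, by a
    -- near-identity transformation `φ` with inverse `ψ`
    (∀ f : MapNF.FormalMap 5, MapNF.HasLinearPart MapNF.nilp23 f →
      ∃ φ ψ : MapNF.FormalMap 5,
        MapNF.HasLinearPart 1 φ ∧ MapNF.HasLinearPart 1 ψ ∧
          MapNF.comp φ ψ = MvPowerSeries.X ∧ MapNF.comp ψ φ = MvPowerSeries.X ∧
          MapNF.IsNormalForm MapNF.nilp23 (MapNF.kerStyle MapNF.nilp23)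
            (MapNF.comp φ (MapNF.comp f ψ))) := by
  refine ⟨MapNF.isStyleAt_kerStyle, fun F => ?_, fun g => ?_, fun f hf => ?_⟩
  · have h := MapNF.homologicalBarOp_eq_zero_iff (φ := F - MapNF.linMap MapNF.nilp23)
    simpa only [Pi.sub_apply, map_sub, MapNF.constantCoeff_linMap, sub_zero, sub_eq_iff_eq_add']
      using h
  · refine and_congr_right fun _ => forall₂_congr fun k _ => ?_
    rw [← MapNF.homologicalBarOp_eq_zero_iff]
    have hmem := MapNF.homogPart_mem_homogMaps k g
    exact ⟨fun h => ⟨MapNF.constantCoeff_eq_zero_of_mem_homogMaps hmem, h.2.1⟩,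
      fun h => ⟨MapNF.isStyleAt_kerStyle k, h.2, hmem⟩⟩
  · obtain ⟨φ, g, hφ, hg, hconj⟩ :=
      MapNF.exists_conj_isNormalForm (fun k _ => MapNF.isStyleAt_kerStyle k) hf
    obtain ⟨ψ, hψ, h1, h2⟩ := MapNF.exists_inverse hφ
    refine ⟨φ, ψ, hφ, hψ, h1, h2, ?_⟩
    rwa [← MapNF.comp_assoc _ hf.hasSubst hψ.hasSubst, hconj,
      MapNF.comp_assoc _ hφ.hasSubst hψ.hasSubst, h1, MapNF.comp_X]
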